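/- **Setting.** Let $G=(V,E)$ be a finite connected undirected graph, let $C_i\subset\mathbb{R}^m$ ($i\in V$) be closed convex sets, let $\bar x\in\mathbb{R}^m$, and suppose that the projection $x^*$ of $\bar x$ onto $\bigcap_{i\in V}C_i$ exists and is $x^*=0$. Norms are Euclidean, $N_C(x)$ is the normal cone of convex analysis (empty if $x\notin C$), and $\delta_C^*(z)=\sup_{x\in C}\langle z,x\rangle$. Write $\bar{\mathbf x}=(\bar x,\dots,\bar x)\in[\mathbb{R}^m]^{|V|}$, and $H_e=\{\mathbf x\in[\mathbb{R}^m]^{|V|}:\mathbf x_i=\mathbf x_j\}$ for $e=\{i,j\}\in E$. For $\mathbf z=(\mathbf z_\alpha)_{\alpha\in V\cup E}$, $\mathbf z_\alpha\in[\mathbb{R}^m]^{|V|}$, put $z_i=[\mathbf z_i]_i$, $\mathbf x(\mathbf z)=\bar{\mathbf x}-\sum_{\alpha\in V\cup E}\mathbf z_\alpha$ and $$F(\mathbf z)=\sum_{i\in V}\delta_{C_i}^*(z_i)+\sum_{e\in E}\delta_{H_e}^*(\mathbf z_e)+\tfrac12\|\mathbf x(\mathbf z)\|^2 .$$ Call $\mathbf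 z$ *sparse* if $[\mathbf z_i]_j=0$ for all $i\in V$ and $j\ne i$, and if for each edge $e=\{i,j\}$ one has $[\mathbf z_e]_k=0$ for $k\notin\{i,j\}$ and $[\mathbf z_e]_i+[\mathbf z_e]_j=0$. **Assumptions on the problem.** 1. (Dual minimizers exist) There are $z_i\in N_{C_i}(x^*)$ with $\sum_{i\in V} z_i=|V|\bar x$. 2. (Regularity of the sets) There are a neighborhood $U$ of $x^*$ and constants $M_{\max}>1$, $M_{\min}>0$, $\kappa_1>0$ such that for every sparse $\mathbf z$ and all points $x_i\in U$ with $z_i\in N_{C_i}(x_i)$ for all $i\in V$ and $[\mathbf x(\mathbf z)]_j\in U$ for all $j\in V$: $M_{\min}\le\|z_i\|\le M_{\max}$ for all $i$, and the hyperplanes $H_i=\{x:\langle z_i,x-x_i\rangle=0\}$ satisfy $d(x,\bigcap_{i\in V}H_i)\le\kappa_1\max_{i\in V}d(x,H_i)$ for all $x\in\mathbb{R}^m$ (with $d(x,\emptyset)=\infty$). 3. (Semismoothness of order 2) There are a neighborhood $U$ of $x^*$ and $\kappa_2>0$ such that for all $i\in V$, $x\in U\cap\partial C_i$ and $z\in N_{C_i}(x)\setminus\{0\}$,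 the hyperplane $H$ through $x$ with normal $z$ satisfies $d(x^*,H)\le\kappa_2\|x-x^*\|^2$. 4. (First order property on normals) There are a neighborhood $U$ of $x^*$ and $\kappa_3>0$ such that for all $i\in V$, $x\in U\cap C_i$ and $z\in N_{C_i}(x)\setminus\{0\}$ there is $z^r\in N_{C_i}(x^*)\setminus\{0\}$ with $\big\|\frac{z}{\|z\|}-\frac{z^r}{\|z^r\|}\big\|\le\kappa_3\|x-x^*\|$. 5. (Linear regularity of the optimal multipliers) With $M_1=\prod_{i\in V}N_{C_i}(x^*)$ and $M_2=\{\mathbf z\in[\mathbb{R}^m]^{|V|}:\sum_{i\in V}\mathbf z_i=|V|\bar x\}$ there is $\kappa_4>0$ with $d(\mathbf z,M_1\cap M_2)\le\kappa_4\,d(\mathbf z,M_2)$ for all $\mathbf z\in M_1$. **Algorithm (distributed Dykstra's algorithm).** Fix $\bar w$ and let $\mathbf f_i^*$ and $\mathbf f_e^*$ be the support functions of $\{\mathbf x:\mathbf x_i\in C_i\}$ and of $H_e$. Start with a sparse $\mathbf z^{1,0}$. For $n=1,2,\dots$ and $w=1,\dots,\bar w$, choose a nonempty $S_{n,w}\subset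 V\cup E$, let $(\mathbf z_\alpha^{n,w})_{\alpha\in S_{n,w}}$ be a minimizer of $$\tfrac12\Big\|\bar{\mathbf x}-\sum_{\alpha\notin S_{n,w}}\mathbf z_\alpha^{n,w-1}-\sum_{\alpha\in S_{n,w}}\mathbf z_\alpha\Big\|^2+\sum_{\alpha\in S_{n,w}}\mathbf f_\alpha^*(\mathbf z_\alpha),$$ and set $\mathbf z_\alpha^{n,w}=\mathbf z_\alpha^{n,w-1}$ for $\alpha\notin S_{n,w}$; after the inner loop set $\mathbf z^{n+1,0}=\mathbf z^{n,\bar w}$. Assume that every block is updated in each outer iteration: for all $n\ge1$ and $\alpha\in V\cup E$ there is $w\in\{1,\dots,\bar w\}$ with $\alpha\in S_{n,w}$. Write $x_i^{n,0}=[\mathbf x(\mathbf z^{n,0})]_i$. **Theorem (linear convergence of the dual value).** There are $r,\rho\in(0,1)$, depending only on the problem and on $\bar w$, such that the following holds for every run of the algorithm. - $F(\mathbf z^{n,0})<\infty$ for all $n\ge2$. - There is $r_0\in(0,1)$, which may depend on the run, with $F(\mathbf z^{n+1,0})\le r_0\,F(\mathbf z^{n-1,0})$ for all $n\ge2$. -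 $F(\mathbf z^{n+1,0})\le r\,F(\mathbf z^{n-1,0})$ for all sufficiently large $n$. - $\tfrac12\sum_{i\in V}\|x_i^{n,0}-x^*\|^2\le F(\mathbf z^{n,0})$ for all $n\ge1$. - The primal iterates converge linearly to $x^*$: there is $K\ge0$, which may depend on the run, with $\|x_i^{n,0}-x^*\|\le K\rho^n$ for all $n\ge1$ and $i\in V$. -/

import Mathlib

open Topology

namespace DistDykstra

/-- The space `ℝ^m` with the Euclidean norm. -/
abbrev Vec (m : ℕ) : Type := EuclideanSpace ℝ (Fin m)

/-- The product space `[ℝ^m]^{|V|}` with the 2-norm. -/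
abbrev ProdVec (V : Type*) (m : ℕ) : Type _ := PiLp 2 (fun _ : V => Vec m)

/-- The index set `V ∪ E` of the dual blocks. -/
abbrev Block {V : Type*} (G : SimpleGraph V) : Type _ := V ⊕ G.edgeSet

/-- A dual variable `𝐳 = (𝐳_α)_{α ∈ V ∪ E}`, each `𝐳_α` in `[ℝ^m]^{|V|}`. -/
abbrev DualVar {V : Type*} (G : SimpleGraph V) (m : ℕ) : Type _ := Block G → ProdVec V m

/-- The support function `δ_C^*(z) = sup_{x ∈ C} ⟪z, x⟫`, that is, the Fenchel conjugate of the
indicator function of `C`. -/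
noncomputable def supportFn {X : Type*} [NormedAddCommGroup X] [InnerProductSpace ℝ X]
    (C : Set X) (z : X) : EReal :=
  ⨆ x ∈ C, ((inner ℝ z x : ℝ) : EReal)

/-- The normal cone `N_C(x)` of convex analysis (empty if `x ∉ C`). -/
def normalCone {X : Type*} [NormedAddCommGroup X] [InnerProductSpace ℝ X]
    (C : Set X) (x : X) : Set X :=
  {z | x ∈ C ∧ ∀ y ∈ C, inner ℝ z (y - x) ≤ 0}

/-- The hyperplane through `x` with normal vector `z`. -/
def hyperplane {X : Type*} [NormedAddCommGroup X] [InnerProductSpace ℝ X]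
    (z x : X) : Set X :=
  {y | inner ℝ z (y - x) = 0}

/-- The set `H_e = {𝐱 : 𝐱_i = 𝐱_j}` of an edge `e = {i, j}`. -/
def edgeSubspace {V : Type*} (m : ℕ) (e : Sym2 V) : Set (ProdVec V m) :=
  {x | ∀ i ∈ e, ∀ j ∈ e, x i = x j}

/-- The set in `[ℝ^m]^{|V|}` whose indicator function is `𝐟_α`: for a vertex `i` it is
`{𝐱 : 𝐱_i ∈ C_i}`, and for an edge `e` it is `H_e`. -/
def blockSet {V : Type*} {m : ℕ} (G : SimpleGraph V) (C : V → Set (Vec m)) :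
    Block G → Set (ProdVec V m)
  | Sum.inl i => {x | x i ∈ C i}
  | Sum.inr e => edgeSubspace m (e : Sym2 V)

/-- The vector of `[ℝ^m]^{|V|}` all of whose components are `xbar`. -/
noncomputable def diagVec (V : Type*) {m : ℕ} (xbar : Vec m) : ProdVec V m :=
  WithLp.toLp 2 (fun _ => xbar)

/-- The primal point `𝐱 = 𝐱̄ - ∑_{α ∈ V ∪ E} 𝐳_α` that belongs to a dual variable. -/
noncomputable def primalPoint {V : Type*} [Fintype V] {m : ℕ} (G : SimpleGraph V)
    [Fintype G.edgeSet] (xbar : Vec m) (z : DualVar G m) : ProdVec V m :=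
  diagVec V xbar - ∑ α, z α

/-- The dual function
`F(𝐳) = ∑_{i ∈ V} δ_{C_i}^*(z_i) + ∑_{e ∈ E} δ_{H_e}^*(𝐳_e) + ½ ‖𝐱̄ - ∑_α 𝐳_α‖²`,
where `z_i = [𝐳_i]_i`. -/
noncomputable def dualF {V : Type*} [Fintype V] {m : ℕ} (G : SimpleGraph V)
    [Fintype G.edgeSet] (C : V → Set (Vec m)) (xbar : Vec m) (z : DualVar G m) : EReal :=
  (∑ i : V, supportFn (C i) (z (Sum.inl i) i))
    + (∑ e : G.edgeSet, supportFn (edgeSubspace m (e : Sym2 V)) (z (Sum.inr e)))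
    + ((1 / 2 * ‖primalPoint G xbar z‖ ^ 2 : ℝ) : EReal)

/-- The sparsity pattern of dual variables: `𝐳_i` is supported at `i`; `𝐳_{(i,j)}` is supported
at `{i, j}` and its two components there sum to zero. -/
def IsSparse {V : Type*} {m : ℕ} (G : SimpleGraph V) (z : DualVar G m) : Prop :=
  (∀ i j : V, j ≠ i → z (Sum.inl i) j = 0) ∧
  ∀ e : G.edgeSet,
    (∀ k : V, k ∉ (e : Sym2 V) → z (Sum.inr e) k = 0) ∧
    ∀ i j : V, (e : Sym2 V) = s(i, j) → z (Sum.inr e) i + z (Sum.inr e) j = 0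

/-- The objective of the block subproblem,
`½ ‖𝐱̄ - ∑_α 𝐳_α‖² + ∑_{α ∈ S} 𝐟_α^*(𝐳_α)`. -/
noncomputable def subObjective {V : Type*} [Fintype V] {m : ℕ} (G : SimpleGraph V)
    [Fintype G.edgeSet] (C : V → Set (Vec m)) (xbar : Vec m) (S : Finset (Block G))
    (z : DualVar G m) : EReal :=
  ((1 / 2 * ‖primalPoint G xbar z‖ ^ 2 : ℝ) : EReal)
    + ∑ α ∈ S, supportFn (blockSet G C α) (z α)

/-- `z'` is obtained from `z` by a minimization over the blocks in `S`, the blocks outside `S`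
being left unchanged. -/
def IsBlockUpdate {V : Type*} [Fintype V] {m : ℕ} (G : SimpleGraph V)
    [Fintype G.edgeSet] (C : V → Set (Vec m)) (xbar : Vec m) (S : Finset (Block G))
    (z z' : DualVar G m) : Prop :=
  (∀ α, α ∉ S → z' α = z α) ∧
  ∀ u : DualVar G m, (∀ α, α ∉ S → u α = z α) →
    subObjective G C xbar S z' ≤ subObjective G C xbar S u

/-- `z n w` (for `n ≥ 1` and `0 ≤ w ≤ wbar`) are the iterates of a run of the distributed
Dykstra's algorithm with `wbar` inner steps per outer iteration and with the block sets
`S n w` (for `n ≥ 1` and `1 ≤ w ≤ wbar`). -/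
structure IsDykstraRun {V : Type*} [Fintype V] {m : ℕ} (G : SimpleGraph V)
    [Fintype G.edgeSet] (C : V → Set (Vec m)) (xbar : Vec m) (wbar : ℕ)
    (S : ℕ → ℕ → Finset (Block G)) (z : ℕ → ℕ → DualVar G m) : Prop where
  init : IsSparse G (z 1 0)
  nonempty : ∀ n, 1 ≤ n → ∀ w, 1 ≤ w → w ≤ wbar → (S n w).Nonempty
  step : ∀ n, 1 ≤ n → ∀ w, w < wbar →
    IsBlockUpdate G C xbar (S n (w + 1)) (z n w) (z n (w + 1))
  next : ∀ n, 1 ≤ n → z (n + 1) 0 = z n wbar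

/-- Every block is updated in each outer iteration. -/
def UpdatesAllBlocks {V : Type*} (G : SimpleGraph V) (wbar : ℕ)
    (S : ℕ → ℕ → Finset (Block G)) : Prop :=
  ∀ n, 1 ≤ n → ∀ α : Block G, ∃ w, 1 ≤ w ∧ w ≤ wbar ∧ α ∈ S n w

/-- `xstar` is the projection of `xbar` onto `⋂ i, C i`. -/
def IsProjection {V : Type*} {m : ℕ} (C : V → Set (Vec m)) (xbar xstar : Vec m) : Prop :=
  xstar ∈ ⋂ i, C i ∧ ∀ y ∈ ⋂ i, C i, ‖xbar - xstar‖ ≤ ‖xbar - y‖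

/-- `M₁ = ∏_i N_{C_i}(x^*)`. -/
def multM1 {V : Type*} {m : ℕ} (C : V → Set (Vec m)) (xstar : Vec m) : Set (ProdVec V m) :=
  {z | ∀ i, z i ∈ normalCone (C i) xstar}

/-- `M₂ = {𝐳 : ∑_i 𝐳_i = |V| x̄}`. -/
def multM2 (V : Type*) [Fintype V] {m : ℕ} (xbar : Vec m) : Set (ProdVec V m) :=
  {z | ∑ i, z i = (Fintype.card V : ℝ) • xbar}

/-- Existence of dual minimizers. -/
def DualMinimizerExists {V : Type*} [Fintype V] {m : ℕ} (C : V → Set (Vec m))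
    (xbar xstar : Vec m) : Prop :=
  ∃ z : V → Vec m, (∀ i, z i ∈ normalCone (C i) xstar) ∧
    ∑ i, z i = (Fintype.card V : ℝ) • xbar

/-- Regularity of the sets `C_i`: near `xstar` the multipliers are bounded and bounded away
from zero, and the hyperplanes `H_i` they define are linearly regular, all with uniform
constants. (The distance `Metric.infEDist` to the empty set is `∞`, so that the last inequality
includes that the hyperplanes have a common point.) -/
def RegularSets {V : Type*} [Fintype V] {m : ℕ} (G : SimpleGraph V) [Fintype G.edgeSet]
    (C : V → Set (Vec m)) (xbar xstar : Vec m) : Prop :=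
  ∃ U ∈ 𝓝 xstar, ∃ Mmax Mmin κ₁ : ℝ, 1 < Mmax ∧ 0 < Mmin ∧ 0 < κ₁ ∧
    ∀ (z : DualVar G m) (x : V → Vec m), IsSparse G z →
      (∀ i, x i ∈ U) →
      (∀ i, z (Sum.inl i) i ∈ normalCone (C i) (x i)) →
      (∀ j, primalPoint G xbar z j ∈ U) →
      (∀ i, Mmin ≤ ‖z (Sum.inl i) i‖ ∧ ‖z (Sum.inl i) i‖ ≤ Mmax) ∧
      ∀ p : Vec m,
        Metric.infEDist p (⋂ i, hyperplane (z (Sum.inl i) i) (x i)) ≤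
          ENNReal.ofReal κ₁ * ⨆ i, Metric.infEDist p (hyperplane (z (Sum.inl i) i) (x i))

/-- Semismoothness of order 2 at `xstar`: a supporting hyperplane of `C_i` at a boundary point
`x` near `xstar` has distance `O(‖x - xstar‖²)` from `xstar`. -/
def Semismooth {V : Type*} {m : ℕ} (C : V → Set (Vec m)) (xstar : Vec m) : Prop :=
  ∃ U ∈ 𝓝 xstar, ∃ κ₂ : ℝ, 0 < κ₂ ∧
    ∀ i, ∀ x ∈ U ∩ frontier (C i), ∀ z ∈ normalCone (C i) x, z ≠ 0 →
      Metric.infDist xstar (hyperplane z x) ≤ κ₂ * ‖x - xstar‖ ^ 2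

/-- First order property on normals. -/
def FirstOrderNormals {V : Type*} {m : ℕ} (C : V → Set (Vec m)) (xstar : Vec m) : Prop :=
  ∃ U ∈ 𝓝 xstar, ∃ κ₃ : ℝ, 0 < κ₃ ∧
    ∀ i, ∀ x ∈ U ∩ C i, ∀ z ∈ normalCone (C i) x, z ≠ 0 →
      ∃ zr ∈ normalCone (C i) xstar, zr ≠ 0 ∧
        ‖(‖z‖⁻¹ • z) - (‖zr‖⁻¹ • zr)‖ ≤ κ₃ * ‖x - xstar‖

/-- Linear regularity of the set `M₁ ∩ M₂` of optimal multipliers. -/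
def RegularMultipliers {V : Type*} [Fintype V] {m : ℕ} (C : V → Set (Vec m))
    (xbar xstar : Vec m) : Prop :=
  ∃ κ₄ : ℝ, 0 < κ₄ ∧ ∀ z ∈ multM1 C xstar,
    Metric.infDist z (multM1 C xstar ∩ multM2 V xbar) ≤ κ₄ * Metric.infDist z (multM2 V xbar)

end DistDykstra

/-! The proof sets a sufficient decrease of `F` against an error bound for `F`, both measured by one
quantity `ε`.

Decrease: a block minimization makes every updated block normal to its set at the new primal point,
and it lowers `F` by at least half the squared primal movement. Let `s` be the total primal movement
in an outer iteration. At the end of the iteration each block is still normal at the primal point of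
its last update, which is within `s` of the final one. Edge blocks make the two end components agree
there, so connectivity makes all final components agree up to `2|V|s`. Each `z_i` is normal to `C_i`
at a point `a_i` close to them as well. With `ε = (2|V|+1)s`, Cauchy–Schwarz shows that `F` drops by
at least `γ ε²`, where `γ` depends only on `|V|` and `wbar`.

Error bound: comparison with any optimal multipliers `zo` gives `F ≤ |V|(Dε + ε²)` if `‖z_i - zo_i‖
≤ D`. On a sublevel set `D` is bounded, because the optimal multipliers are bounded and boundedness
passes to all sublevel sets by convexity and compactness. Since `ε → 0`, it follows that `F → 0`.
Near the solution, the first order property of normals and the linear regularity of the multipliers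
give `D = O(√F + ε)`, hence `F ≤ K ε²` with `K` independent of the run.

Together, `F_new + γε² ≤ F_old` and `F_new ≤ Kε²` give the factor `K/(γ+K)`. As `½‖x‖² ≤ F`, the
primal rate is its square root. -/

namespace DistDykstra

/-! ### Support functions, normal cones and the proximal step -/

section Support

variable {X : Type*} [NormedAddCommGroup X] [InnerProductSpace ℝ X]

theorem ereal_coe_sum {ι : Type*} (s : Finset ι) (f : ι → ℝ) :
    ((∑ i ∈ s, f i : ℝ) : EReal) = ∑ i ∈ s, (f i : EReal) := by
  classical
  induction s using Finset.induction_on with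
  | empty => simp
  | insert a s ha ih => rw [Finset.sum_insert ha, Finset.sum_insert ha, EReal.coe_add, ih]

theorem le_supportFn {C : Set X} {x : X} (hx : x ∈ C) (z : X) :
    ((inner ℝ z x : ℝ) : EReal) ≤ supportFn C z :=
  le_iSup₂ (f := fun x (_ : x ∈ C) => ((inner ℝ z x : ℝ) : EReal)) x hx

theorem supportFn_nonneg {C : Set X} (h0 : (0 : X) ∈ C) (z : X) : 0 ≤ supportFn C z := by
  simpa using le_supportFn h0 z

theorem supportFn_zero_le {C : Set X} : supportFn C (0 : X) ≤ 0 := by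
  simp [supportFn]

theorem supportFn_eq_of_mem_normalCone {C : Set X} {x z : X} (h : z ∈ normalCone C x) :
    supportFn C z = ((inner ℝ z x : ℝ) : EReal) := by
  refine le_antisymm (iSup₂_le fun y hy => ?_) (le_supportFn h.1 z)
  have := h.2 y hy
  rw [inner_sub_right] at this
  exact EReal.coe_le_coe_iff.2 (by linarith)

theorem inner_le_of_mem_normalCone {C : Set X} {x y z : X} (h : z ∈ normalCone C x)
    (hy : y ∈ C) : (inner ℝ z y : ℝ) ≤ inner ℝ z x := by
  have := h.2 y hy
  rw [inner_sub_right] at this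
  linarith

theorem inner_nonneg_of_mem_normalCone {C : Set X} {x z : X} (h0 : (0 : X) ∈ C)
    (h : z ∈ normalCone C x) : (0 : ℝ) ≤ inner ℝ z x := by
  simpa using inner_le_of_mem_normalCone h h0

theorem smul_mem_normalCone {C : Set X} {x z : X} (h : z ∈ normalCone C x) {t : ℝ}
    (ht : 0 ≤ t) : t • z ∈ normalCone C x := by
  refine ⟨h.1, fun y hy => ?_⟩
  rw [real_inner_smul_left]
  exact mul_nonpos_of_nonneg_of_nonpos ht (h.2 y hy)

theorem zero_mem_normalCone {C : Set X} {x : X} (hx : x ∈ C) : (0 : X) ∈ normalCone C x :=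
  ⟨hx, fun y _ => by simp⟩

/-- Moreau decomposition: a minimizer of `v ↦ ½ ‖g - v‖² + δ_B^*(v)` is a normal vector of `B`
at the residual `g - v`. -/
theorem mem_normalCone_of_forall_prox_le [CompleteSpace X] {B : Set X} (hne : B.Nonempty)
    (hcl : IsClosed B) (hcv : Convex ℝ B) {x z : X}
    (h : ∀ v : X, ((1 / 2 * ‖x‖ ^ 2 : ℝ) : EReal) + supportFn B z ≤
      ((1 / 2 * ‖x + z - v‖ ^ 2 : ℝ) : EReal) + supportFn B v) :
    z ∈ normalCone B x := by
  -- For the projection `p` of `x + z`, the competitor `x + z - p` is normal at `p`, so its support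
  -- value is finite. With `⟪z, p⟫` as a lower bound for the support value of `z`, the inequality
  -- collapses to `½‖x - p‖² ≤ 0`.
  obtain ⟨p, hp, hmin⟩ := exists_norm_eq_iInf_of_complete_convex hne hcl.isComplete hcv (x + z)
  rw [norm_eq_iInf_iff_real_inner_le_zero hcv hp] at hmin
  have hv : x + z - p ∈ normalCone B p := ⟨hp, hmin⟩
  have h1 := h (x + z - p)
  rw [supportFn_eq_of_mem_normalCone hv] at h1
  have h2 := (add_le_add_right (le_supportFn hp z)
    ((1 / 2 * ‖x‖ ^ 2 : ℝ) : EReal)).trans h1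
  rw [← EReal.coe_add, ← EReal.coe_add, EReal.coe_le_coe_iff] at h2
  have h3 : x + z - (x + z - p) = p := by abel
  have h4 : (inner ℝ (x + z - p) p : ℝ) = inner ℝ x p + inner ℝ z p - ‖p‖ ^ 2 := by
    rw [inner_sub_left, inner_add_left, real_inner_self_eq_norm_sq]
  rw [h3, h4] at h2
  have h5 := norm_sub_sq_real x p
  have h6 : ‖x - p‖ = 0 := by
    have := norm_nonneg (x - p)
    nlinarith
  have h7 : x = p := sub_eq_zero.1 (norm_eq_zero.1 h6)
  subst h7
  simpa using hv

end Support

/-! ### Geometry of the block sets -/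

section Blocks

variable {V : Type*} {m : ℕ} {G : SimpleGraph V} {C : V → Set (Vec m)}

theorem isClosed_edgeSubspace (e : Sym2 V) : IsClosed (edgeSubspace m e : Set (ProdVec V m)) := by
  have : (edgeSubspace m e : Set (ProdVec V m)) =
      ⋂ i ∈ e, ⋂ j ∈ e, {x : ProdVec V m | x i = x j} := by
    ext x
    simp [edgeSubspace]
  rw [this]
  refine isClosed_biInter fun i _ => isClosed_biInter fun j _ => ?_
  exact isClosed_eq (by fun_prop) (by fun_prop)

theorem isClosed_blockSet (hclosed : ∀ i, IsClosed (C i)) (α : Block G) :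
    IsClosed (blockSet G C α) := by
  cases α with
  | inl i => exact (hclosed i).preimage (by fun_prop : Continuous fun x : ProdVec V m => x i)
  | inr e => exact isClosed_edgeSubspace _

theorem convex_blockSet (hconvex : ∀ i, Convex ℝ (C i)) (α : Block G) :
    Convex ℝ (blockSet G C α) := by
  cases α with
  | inl i =>
    intro x hx y hy a b ha hb hab
    simpa [blockSet] using hconvex i hx hy ha hb hab
  | inr e =>
    intro x hx y hy a b ha hb hab i hi j hj
    simp [hx i hi j hj, hy i hi j hj]

theorem zero_mem_blockSet (h0 : ∀ i, (0 : Vec m) ∈ C i) (α : Block G) :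
    (0 : ProdVec V m) ∈ blockSet G C α := by
  cases α with
  | inl i => simpa [blockSet] using h0 i
  | inr e =>
    intro i _ j _
    simp

end Blocks

/-! ### One block minimization: normality and decrease -/

section Step

variable {V : Type*} [Fintype V] {m : ℕ} {G : SimpleGraph V} [Fintype G.edgeSet]
  {C : V → Set (Vec m)} {xbar : Vec m}

theorem primalPoint_update [DecidableEq (Block G)] (z : DualVar G m) (α : Block G)
    (v : ProdVec V m) :
    primalPoint G xbar (Function.update z α v) = primalPoint G xbar z + z α - v := by
  unfold primalPoint
  have h1 := Finset.add_sum_erase Finset.univ z (Finset.mem_univ α)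
  have h2 := Finset.add_sum_erase Finset.univ (Function.update z α v) (Finset.mem_univ α)
  have h3 : ∑ β ∈ Finset.univ.erase α, Function.update z α v β =
      ∑ β ∈ Finset.univ.erase α, z β :=
    Finset.sum_congr rfl fun β hβ => Function.update_of_ne (Finset.ne_of_mem_erase hβ) _ _
  rw [← h1, ← h2, h3, Function.update_self]
  abel

/-- A joint minimizer over `S` is also a minimizer in each single block of `S`, which is a proximal
problem. The support terms of the other blocks must be known to be finite before they cancel in
`EReal`. -/
theorem IsBlockUpdate.mem_normalCone (h0 : ∀ i, (0 : Vec m) ∈ C i)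
    (hclosed : ∀ i, IsClosed (C i)) (hconvex : ∀ i, Convex ℝ (C i))
    {S : Finset (Block G)} {z z' : DualVar G m} (h : IsBlockUpdate G C xbar S z z')
    {α : Block G} (hα : α ∈ S) :
    z' α ∈ normalCone (blockSet G C α) (primalPoint G xbar z') := by
  classical
  refine mem_normalCone_of_forall_prox_le ⟨0, zero_mem_blockSet h0 α⟩
    (isClosed_blockSet hclosed α) (convex_blockSet hconvex α) fun v => ?_
  set R : EReal := ∑ β ∈ S.erase α, supportFn (blockSet G C β) (z' β) with hR
  have hsum : ∀ u : DualVar G m, ∑ β ∈ S, supportFn (blockSet G C β) (u β) =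
      supportFn (blockSet G C α) (u α) + ∑ β ∈ S.erase α, supportFn (blockSet G C β) (u β) :=
    fun u => (Finset.add_sum_erase S (fun β => supportFn (blockSet G C β) (u β)) hα).symm
  have hR0 : 0 ≤ R := Finset.sum_nonneg fun β _ => supportFn_nonneg (zero_mem_blockSet h0 β) _
  -- The competitor that vanishes on `S` has a finite objective.
  have hRtop : R ≠ ⊤ := by
    intro htop
    have hz := h.2 (fun β => if β ∈ S then 0 else z β) fun β hβ => by simp [hβ]
    unfold subObjective at hz
    rw [hsum z', ← hR, htop, EReal.add_top_of_ne_bot, EReal.coe_add_top, top_le_iff] at hz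
    · have h1 : ∑ β ∈ S, supportFn (blockSet G C β)
          ((fun β => if β ∈ S then 0 else z β : DualVar G m) β) ≤ 0 := by
        refine Finset.sum_nonpos fun β hβ => ?_
        simpa [hβ] using supportFn_zero_le
      have h2 := add_le_add_right h1
        ((1 / 2 * ‖primalPoint G xbar (fun β => if β ∈ S then 0 else z β)‖ ^ 2 : ℝ) : EReal)
      rw [hz, add_zero] at h2
      exact EReal.coe_ne_top _ (top_le_iff.1 h2)
    · exact ne_of_gt (lt_of_lt_of_le (EReal.bot_lt_coe 0)
        (supportFn_nonneg (zero_mem_blockSet h0 α) _))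
  have hRbot : R ≠ ⊥ := ne_of_gt (lt_of_lt_of_le (EReal.bot_lt_coe 0) hR0)
  have hu := h.2 (Function.update z' α v) fun β hβ => by
    rw [Function.update_of_ne (by rintro rfl; exact hβ hα), h.1 β hβ]
  unfold subObjective at hu
  rw [hsum z', hsum (Function.update z' α v), primalPoint_update, Function.update_self] at hu
  have hrest : ∑ β ∈ S.erase α, supportFn (blockSet G C β) (Function.update z' α v β) = R :=
    Finset.sum_congr rfl fun β hβ => by
      rw [Function.update_of_ne (Finset.ne_of_mem_erase hβ)]
  rw [hrest, ← hR] at hu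
  lift R to ℝ using ⟨hRtop, hRbot⟩ with r
  rw [← add_assoc, ← add_assoc] at hu
  exact (EReal.addLECancellable_coe r).add_le_add_iff_right.1 hu

/-- The dual objective as a sum over the blocks. -/
noncomputable def blockF (G : SimpleGraph V) [Fintype G.edgeSet] (C : V → Set (Vec m))
    (xbar : Vec m) (z : DualVar G m) : EReal :=
  ∑ α, supportFn (blockSet G C α) (z α) + ((1 / 2 * ‖primalPoint G xbar z‖ ^ 2 : ℝ) : EReal)

/-- The new primal point `x'` is a subgradient of the support function at each updated block.
Summing the subgradient inequalities leaves `⟪x' - x, x'⟫`, and polarization turns it into the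
squared movement. No finiteness of the old value is needed. -/
theorem IsBlockUpdate.blockF_add_le (h0 : ∀ i, (0 : Vec m) ∈ C i)
    (hclosed : ∀ i, IsClosed (C i)) (hconvex : ∀ i, Convex ℝ (C i))
    {S : Finset (Block G)} {z z' : DualVar G m} (h : IsBlockUpdate G C xbar S z z') :
    blockF G C xbar z' +
      ((1 / 2 * ‖primalPoint G xbar z' - primalPoint G xbar z‖ ^ 2 : ℝ) : EReal) ≤
      blockF G C xbar z := by
  set x := primalPoint G xbar z with hx
  set x' := primalPoint G xbar z' with hx'
  have hblock : ∀ α, supportFn (blockSet G C α) (z' α) + ((inner ℝ (z α - z' α) x' : ℝ) : EReal)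
      ≤ supportFn (blockSet G C α) (z α) := by
    intro α
    by_cases hα : α ∈ S
    · have hn := h.mem_normalCone h0 hclosed hconvex hα
      rw [supportFn_eq_of_mem_normalCone hn, ← EReal.coe_add, inner_sub_left]
      have := le_supportFn hn.1 (z α)
      rw [← hx'] at this ⊢
      convert this using 2
      ring
    · rw [h.1 α hα]
      simp
  have hsum := Finset.sum_le_sum fun α (_ : α ∈ Finset.univ) => hblock α
  rw [Finset.sum_add_distrib, ← ereal_coe_sum, ← sum_inner, Finset.sum_sub_distrib] at hsum
  have hd : ∑ α, z α - ∑ α, z' α = x' - x := by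
    rw [hx, hx']
    unfold primalPoint
    abel
  rw [hd] at hsum
  unfold blockF
  refine le_trans (le_of_eq ?_) (add_le_add_left hsum ((1 / 2 * ‖x‖ ^ 2 : ℝ) : EReal))
  rw [add_assoc, add_assoc, ← EReal.coe_add, ← EReal.coe_add]
  congr 2
  rw [norm_sub_sq_real, inner_sub_left, real_inner_self_eq_norm_sq, real_inner_comm]
  ring

end Step

/-! ### Edge blocks and connectivity -/

section Edges

variable {V : Type*} {m : ℕ} {G : SimpleGraph V}

/-- The sparsity pattern of a dual block that belongs to an edge. -/
def EdgeSparse (e : Sym2 V) (z : ProdVec V m) : Prop :=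
  (∀ k : V, k ∉ e → z k = 0) ∧ ∀ i j : V, e = s(i, j) → z i + z j = 0

theorem IsSparse.edgeSparse {z : DualVar G m} (hz : IsSparse G z) (e : G.edgeSet) :
    EdgeSparse (e : Sym2 V) (z (Sum.inr e)) :=
  hz.2 e

theorem not_isDiag_of_edge (e : G.edgeSet) : ¬(e : Sym2 V).IsDiag :=
  G.not_isDiag_of_mem_edgeSet e.2

theorem eq_of_mem_edgeSubspace (hconn : G.Connected) {x : ProdVec V m}
    (hx : ∀ e : G.edgeSet, x ∈ edgeSubspace m (e : Sym2 V)) (i j : V) : x i = x j := by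
  obtain ⟨p⟩ := hconn.preconnected i j
  induction p with
  | nil => rfl
  | @cons u v w huv p ih =>
    exact (hx ⟨s(u, v), huv⟩ u (by simp) v (by simp)).trans ih

end Edges

/-! ### Sparsity of the dual variables -/

section Sparse

variable {V : Type*} [Fintype V] {m : ℕ}

theorem inner_single_right [DecidableEq V] (z : ProdVec V m) (j : V) (w : Vec m) :
    (inner ℝ z (PiLp.single 2 j w) : ℝ) = inner ℝ (z j) w := by
  rw [PiLp.inner_apply, Fintype.sum_eq_single j]
  · simp
  · intro i hi
    simp [hi]

theorem EdgeSparse.sum_inner {e : Sym2 V} (he : ¬e.IsDiag) {z : ProdVec V m}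
    (hz : EdgeSparse e z) {h : ProdVec V m} (hh : h ∈ edgeSubspace m e) :
    (inner ℝ z h : ℝ) = 0 := by
  induction e using Sym2.ind with
  | _ i j =>
    have hij : i ≠ j := by simpa using he
    rw [PiLp.inner_apply, Fintype.sum_eq_add i j hij, hh i (by simp) j (by simp),
      ← inner_add_left, hz.2 i j rfl, inner_zero_left]
    rintro k ⟨hk1, hk2⟩
    rw [hz.1 k (by simp [hk1, hk2]), inner_zero_left]

theorem EdgeSparse.sum_eq_zero {e : Sym2 V} (he : ¬e.IsDiag) {z : ProdVec V m}
    (hz : EdgeSparse e z) : ∑ k, z k = 0 := by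
  induction e using Sym2.ind with
  | _ i j =>
    have hij : i ≠ j := by simpa using he
    rw [Fintype.sum_eq_add i j hij, hz.2 i j rfl]
    rintro k ⟨hk1, hk2⟩
    exact hz.1 k (by simp [hk1, hk2])

/-- Two kinds of test vectors in `H_e` suffice: `z k` placed at a vertex `k` off the edge, and `z i
+ z j` placed at both ends. -/
theorem edgeSparse_of_inner_nonpos {e : Sym2 V} (he : ¬e.IsDiag) {z : ProdVec V m}
    (hz : ∀ h ∈ edgeSubspace m e, (inner ℝ z h : ℝ) ≤ 0) : EdgeSparse e z := by
  classical
  refine ⟨fun k hk => ?_, fun i j hij => ?_⟩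
  · have h1 := hz (PiLp.single 2 k (z k)) fun i hi j hj => by
      have hik : i ≠ k := by rintro rfl; exact hk hi
      have hjk : j ≠ k := by rintro rfl; exact hk hj
      simp [hik, hjk]
    rw [inner_single_right] at h1
    exact real_inner_self_nonpos.1 h1
  · subst hij
    have hij : i ≠ j := by simpa using he
    have h1 := hz (PiLp.single 2 i (z i + z j) + PiLp.single 2 j (z i + z j)) fun a ha b hb => by
      rcases Sym2.mem_iff.1 ha with rfl | rfl <;> rcases Sym2.mem_iff.1 hb with rfl | rfl <;>
        simp [hij, hij.symm]
    rw [inner_add_right, inner_single_right, inner_single_right, ← inner_add_left] at h1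
    exact real_inner_self_nonpos.1 h1

theorem edgeSparse_of_mem_normalCone {e : Sym2 V} (he : ¬e.IsDiag) {x z : ProdVec V m}
    (hz : z ∈ normalCone (edgeSubspace m e) x) : EdgeSparse e z := by
  refine edgeSparse_of_inner_nonpos he fun h hh => ?_
  have := hz.2 (x + h) fun i hi j hj => by
    rw [PiLp.add_apply, PiLp.add_apply, hz.1 i hi j hj, hh i hi j hj]
  simpa using this

theorem vertexSparse_of_mem_normalCone {Ci : Set (Vec m)} {i : V} {x z : ProdVec V m}
    (hz : z ∈ normalCone {x : ProdVec V m | x i ∈ Ci} x) :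
    (∀ j, j ≠ i → z j = 0) ∧ z i ∈ normalCone Ci (x i) := by
  classical
  refine ⟨fun j hj => ?_, hz.1, fun y hy => ?_⟩
  · have h1 := hz.2 (x + PiLp.single 2 j (z j)) (by simpa [hj.symm] using hz.1)
    rw [add_sub_cancel_left, inner_single_right] at h1
    exact real_inner_self_nonpos.1 h1
  · have h1 := hz.2 (x + PiLp.single 2 i (y - x i)) (by simpa using hy)
    rwa [add_sub_cancel_left, inner_single_right] at h1

theorem supportFn_vertex {Ci : Set (Vec m)} {i : V} {z : ProdVec V m}
    (hz : ∀ j, j ≠ i → z j = 0) :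
    supportFn {x : ProdVec V m | x i ∈ Ci} z = supportFn Ci (z i) := by
  classical
  have hin : ∀ x : ProdVec V m, (inner ℝ z x : ℝ) = inner ℝ (z i) (x i) := fun x => by
    rw [PiLp.inner_apply, Fintype.sum_eq_single i]
    intro j hj
    rw [hz j hj, inner_zero_left]
  refine le_antisymm (iSup₂_le fun x hx => ?_) (iSup₂_le fun x hx => ?_)
  · rw [hin]
    exact le_supportFn (show x i ∈ Ci from hx) (z i)
  · have h1 := le_supportFn (C := {x : ProdVec V m | x i ∈ Ci}) (x := PiLp.single 2 i x)
      (by simpa using hx) z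
    rwa [inner_single_right] at h1

variable {G : SimpleGraph V} {C : V → Set (Vec m)} {xbar : Vec m}

variable [Fintype G.edgeSet]

theorem IsSparse.dualF_eq {z : DualVar G m} (hz : IsSparse G z) :
    dualF G C xbar z = blockF G C xbar z := by
  unfold dualF blockF
  rw [Fintype.sum_sum_type]
  congr 2
  exact Finset.sum_congr rfl fun i _ => (supportFn_vertex (hz.1 i)).symm

theorem IsSparse.sum_primalPoint {z : DualVar G m} (hz : IsSparse G z) :
    ∑ j, primalPoint G xbar z j = (Fintype.card V : ℝ) • xbar - ∑ i, z (Sum.inl i) i := by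
  have h1 : ∀ j, primalPoint G xbar z j =
      xbar - (∑ i, z (Sum.inl i) j + ∑ e : G.edgeSet, z (Sum.inr e) j) := fun j => by
    simp [primalPoint, diagVec, Fintype.sum_sum_type]
  have h2 : ∑ j, ∑ i, z (Sum.inl i) j = ∑ i, z (Sum.inl i) i := by
    rw [Finset.sum_comm]
    refine Finset.sum_congr rfl fun i _ => ?_
    exact Fintype.sum_eq_single i fun j hj => hz.1 i j hj
  have h3 : ∑ j, ∑ e : G.edgeSet, z (Sum.inr e) j = 0 := by
    rw [Finset.sum_comm]
    exact Finset.sum_eq_zero fun e _ => (hz.edgeSparse e).sum_eq_zero (not_isDiag_of_edge e)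
  simp_rw [h1, Finset.sum_sub_distrib, Finset.sum_add_distrib, h2, h3]
  simp [Nat.cast_smul_eq_nsmul]

theorem IsBlockUpdate.isSparse (h0 : ∀ i, (0 : Vec m) ∈ C i)
    (hclosed : ∀ i, IsClosed (C i)) (hconvex : ∀ i, Convex ℝ (C i))
    {S : Finset (Block G)} {z z' : DualVar G m} (h : IsBlockUpdate G C xbar S z z')
    (hz : IsSparse G z) : IsSparse G z' := by
  refine ⟨fun i j hj => ?_, fun e => ?_⟩
  · by_cases hS : Sum.inl i ∈ S
    · exact (vertexSparse_of_mem_normalCone (h.mem_normalCone h0 hclosed hconvex hS)).1 j hj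
    · rw [h.1 _ hS]
      exact hz.1 i j hj
  · by_cases hS : Sum.inr e ∈ S
    · exact edgeSparse_of_mem_normalCone (not_isDiag_of_edge e)
        (h.mem_normalCone h0 hclosed hconvex hS)
    · rw [h.1 _ hS]
      exact hz.2 e

/-- The subspace `H_e` as a submodule. -/
def edgeSubmodule (m : ℕ) (e : Sym2 V) : Submodule ℝ (ProdVec V m) where
  carrier := edgeSubspace m e
  add_mem' := fun {x y} hx hy i hi j hj => by
    rw [PiLp.add_apply, PiLp.add_apply, hx i hi j hj, hy i hi j hj]
  zero_mem' := fun i _ j _ => rfl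
  smul_mem' := fun c x hx i hi j hj => by
    rw [PiLp.smul_apply, PiLp.smul_apply, hx i hi j hj]

/-- On a connected graph, a vector whose components sum to zero is a sum of edge blocks. -/
theorem exists_sum_edgeSparse (hconn : G.Connected) (v : ProdVec V m) (hv : ∑ i, v i = 0) :
    ∃ y : G.edgeSet → ProdVec V m, (∀ e : G.edgeSet, EdgeSparse (e : Sym2 V) (y e)) ∧
      ∑ e, y e = v := by
  -- The sum of the spaces `H_eᗮ` is the orthogonal complement of `⋂ H_e`, and by connectivity that
  -- intersection contains only constant vectors.
  have hmem : v ∈ ⨆ e ∈ (Finset.univ : Finset G.edgeSet), (edgeSubmodule m (e : Sym2 V))ᗮ := by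
    simp only [Finset.mem_univ, iSup_pos]
    rw [← Submodule.orthogonal_orthogonal (⨆ e : G.edgeSet, (edgeSubmodule m (e : Sym2 V))ᗮ),
      ← Submodule.iInf_orthogonal, Submodule.mem_orthogonal]
    intro u hu
    have hu' : ∀ e : G.edgeSet, u ∈ edgeSubspace m (e : Sym2 V) := fun e => by
      have := (Submodule.mem_iInf _).1 hu e
      rwa [Submodule.orthogonal_orthogonal] at this
    obtain ⟨i⟩ := hconn.nonempty
    rw [PiLp.inner_apply]
    have : ∀ j, (inner ℝ (u j) (v j) : ℝ) = inner ℝ (u i) (v j) := fun j => by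
      rw [eq_of_mem_edgeSubspace hconn hu' j i]
    simp_rw [this]
    rw [← inner_sum, hv, inner_zero_right]
  obtain ⟨μ, hμ⟩ := (Submodule.mem_iSup_finset_iff_exists_sum _ _).1 hmem
  refine ⟨fun e => μ e, fun e => ?_, hμ⟩
  refine edgeSparse_of_inner_nonpos (not_isDiag_of_edge e) fun h hh => ?_
  rw [real_inner_comm]
  exact (Submodule.mem_orthogonal _ _ |>.1 (μ e).2 h hh).le

end Sparse

/-! ### Dual gap and propagation of deviations along walks -/

section Estimates

variable {V : Type*} [Fintype V]

/-- The dual gap is controlled by the deviation `ε` of the points `x i`, `a i` from a common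
point `y`, multiplied by the distance `D` of the multipliers to optimal multipliers. -/
theorem gap_le_of_optimal_multipliers {E : Type*} [NormedAddCommGroup E] [InnerProductSpace ℝ E]
    {z zo a x : V → E} {y : E} {ε D : ℝ} (hx : ∀ i, ‖x i - y‖ ≤ ε)
    (ha : ∀ i, ‖a i - y‖ ≤ ε) (hD : ∀ i, ‖z i - zo i‖ ≤ D)
    (hzo : ∀ i, (inner ℝ (zo i) (a i) : ℝ) ≤ 0)
    (hsum : ∑ i, (zo i - z i) = ∑ i, x i) :
    ∑ i, (inner ℝ (z i) (a i) : ℝ) + 1 / 2 * ∑ i, ‖x i‖ ^ 2 ≤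
      Fintype.card V * (D * ε + ε ^ 2) := by
  -- The last bracket is not small for a single `i`; it cancels in the sum over `i` by `hsum`.
  have hterm : ∀ i, (inner ℝ (z i) (a i) : ℝ) + 1 / 2 * ‖x i‖ ^ 2 ≤
      (D * ε + ε ^ 2) + (inner ℝ (x i) y - inner ℝ (zo i - z i) y) := by
    intro i
    have h1 : (inner ℝ (z i - zo i) (a i - y) : ℝ) ≤ D * ε :=
      (real_inner_le_norm _ _).trans (mul_le_mul (hD i) (ha i) (norm_nonneg _)
        ((norm_nonneg _).trans (hD i)))
    have h2 := norm_sub_sq_real (x i) y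
    have h3 := hx i
    have h4 := norm_nonneg (x i - y)
    have h5 := hzo i
    have h6 := sq_nonneg ‖y‖
    simp only [inner_sub_left, inner_sub_right] at h1 ⊢
    nlinarith
  have h := Finset.sum_le_sum fun i (_ : i ∈ Finset.univ) => hterm i
  rw [Finset.sum_add_distrib, Finset.sum_add_distrib, Finset.sum_sub_distrib, ← sum_inner,
    ← sum_inner, hsum, sub_self, add_zero, ← Finset.mul_sum] at h
  simpa [mul_add] using h

theorem norm_sub_le_of_connected {G : SimpleGraph V} (hconn : G.Connected) {E : Type*}
    [NormedAddCommGroup E] {x : V → E} {t : ℝ}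
    (h : ∀ i j, G.Adj i j → ‖x i - x j‖ ≤ t) (ht : 0 ≤ t) (i j : V) :
    ‖x i - x j‖ ≤ Fintype.card V * t := by
  classical
  have hwalk : ∀ {i j : V} (p : G.Walk i j), ‖x i - x j‖ ≤ p.length * t := by
    intro i j p
    induction p with
    | nil => simp
    | @cons u v w huv p ih =>
      have h1 := norm_sub_le_norm_sub_add_norm_sub (x u) (x v) (x w)
      have h2 := h u v huv
      rw [SimpleGraph.Walk.length_cons]
      push_cast
      linarith
  obtain ⟨p, hp⟩ := (hconn.preconnected i j).exists_isPath
  refine (hwalk p).trans (mul_le_mul_of_nonneg_right ?_ ht)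
  exact_mod_cast hp.length_lt.le

end Estimates

/-! ### Boundedness of the multipliers on sublevel sets -/

section Coercivity

variable {V : Type*} [Fintype V] {m : ℕ} {C : V → Set (Vec m)} {xbar : Vec m}

/-- The multipliers whose reduced dual value is (roughly) at most `c`. -/
def multSublevel (C : V → Set (Vec m)) (xbar : Vec m) (c : ℝ) : Set (V → Vec m) :=
  {z | (∀ y : V → Vec m, (∀ i, y i ∈ C i) → ∑ i, (inner ℝ (z i) (y i) : ℝ) ≤ c) ∧
    ‖∑ i, z i - (Fintype.card V : ℝ) • xbar‖ ≤ c}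

theorem multSublevel_mono {c d : ℝ} (h : c ≤ d) :
    multSublevel C xbar c ⊆ multSublevel C xbar d :=
  fun _ hz => ⟨fun y hy => (hz.1 y hy).trans h, hz.2.trans h⟩

theorem isClosed_multSublevel (c : ℝ) : IsClosed (multSublevel C xbar c) := by
  unfold multSublevel
  simp only [Set.ofPred_and, Set.ofPred_forall]
  refine IsClosed.inter (isClosed_iInter fun y => isClosed_iInter fun _ => ?_) ?_
  · exact isClosed_le (by fun_prop) continuous_const
  · exact isClosed_le (by fun_prop) continuous_const

theorem mem_multSublevel_zero_iff (h0 : ∀ i, (0 : Vec m) ∈ C i) {z : V → Vec m} :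
    z ∈ multSublevel C xbar 0 ↔
      (∀ i, z i ∈ normalCone (C i) 0) ∧ ∑ i, z i = (Fintype.card V : ℝ) • xbar := by
  classical
  constructor
  · rintro ⟨h1, h2⟩
    refine ⟨fun i => ⟨h0 i, fun y hy => ?_⟩, sub_eq_zero.1 (norm_le_zero_iff.1 h2)⟩
    have h3 := h1 (Pi.single i y) fun j => by
      by_cases hj : j = i
      · subst hj
        simpa using hy
      · simpa [hj] using h0 j
    rw [Fintype.sum_eq_single i fun j hj => by simp [hj]] at h3
    simpa using h3
  · rintro ⟨h1, h2⟩
    refine ⟨fun y hy => Finset.sum_nonpos fun i _ => ?_, by simp [h2]⟩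
    simpa using (h1 i).2 (y i) (hy i)

theorem combination_mem_multSublevel {zs z : V → Vec m} {c t : ℝ}
    (hzs : zs ∈ multSublevel C xbar 0) (hz : z ∈ multSublevel C xbar c) (ht : 0 ≤ t)
    (ht1 : t ≤ 1) : zs + t • (z - zs) ∈ multSublevel C xbar (t * c) := by
  refine ⟨fun y hy => ?_, ?_⟩
  · have h1 := hzs.1 y hy
    have h2 := hz.1 y hy
    have h3 : ∑ i, (inner ℝ ((zs + t • (z - zs)) i) (y i) : ℝ) =
        (1 - t) * ∑ i, (inner ℝ (zs i) (y i) : ℝ) + t * ∑ i, (inner ℝ (z i) (y i) : ℝ) := by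
      rw [Finset.mul_sum, Finset.mul_sum, ← Finset.sum_add_distrib]
      refine Finset.sum_congr rfl fun i _ => ?_
      simp only [Pi.add_apply, Pi.smul_apply, Pi.sub_apply, inner_add_left,
        real_inner_smul_left, inner_sub_left]
      ring
    rw [h3]
    nlinarith
  · have h1 : ∑ i, zs i = (Fintype.card V : ℝ) • xbar :=
      sub_eq_zero.1 (norm_le_zero_iff.1 hzs.2)
    have h2 : ∑ i, (zs + t • (z - zs)) i - (Fintype.card V : ℝ) • xbar =
        t • (∑ i, z i - (Fintype.card V : ℝ) • xbar) := by
      simp only [Pi.add_apply, Pi.smul_apply, Pi.sub_apply, Finset.sum_add_distrib,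
        ← Finset.smul_sum, Finset.sum_sub_distrib, h1]
      abel
    rw [h2, norm_smul, Real.norm_of_nonneg ht]
    exact mul_le_mul_of_nonneg_left hz.2 ht

/-- If the optimal multipliers form a nonempty bounded set, then all sublevel sets are bounded. -/
theorem exists_bound_multSublevel {M : ℝ} {zs : V → Vec m}
    (hzs : zs ∈ multSublevel C xbar 0)
    (hM : ∀ z ∈ multSublevel C xbar 0, ‖z‖ ≤ M) (c : ℝ) :
    ∃ B, ∀ z ∈ multSublevel C xbar c, ‖z‖ ≤ B := by
  by_contra! hcon
  -- No optimal multiplier can lie at distance `R` from `zs`. The nested compact sets `K k` will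
  -- produce one.
  obtain ⟨R, hR⟩ : ∃ R, R = M + ‖zs‖ + 1 := ⟨_, rfl⟩
  have hRpos : 0 < R := by
    have h1 := hM zs hzs
    have h2 := norm_nonneg zs
    linarith
  let K : ℕ → Set (V → Vec m) := fun k =>
    Metric.sphere zs R ∩ multSublevel C xbar (1 / ((k : ℝ) + 1))
  have hK : (⋂ k, K k).Nonempty := by
    refine IsCompact.nonempty_iInter_of_sequence_nonempty_isCompact_isClosed K ?_ ?_ ?_ ?_
    · intro k
      refine Set.inter_subset_inter_right _ (multSublevel_mono ?_)
      push_cast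
      exact one_div_le_one_div_of_le (by positivity) (by linarith)
    · intro k
      -- The point is so far away that the scaling `t = R / ‖z - zs‖`, which moves it to the sphere,
      -- satisfies both `t ≤ 1` and `t * c ≤ 1 / (k + 1)`.
      obtain ⟨z, hz, hzB⟩ := hcon (‖zs‖ + R + R * |c| * (k + 1))
      have hd : R + R * |c| * (k + 1) < ‖z - zs‖ := by
        have := norm_sub_norm_le z zs
        linarith
      have hRc : 0 ≤ R * |c| * (k + 1) := by positivity
      have hdpos : 0 < ‖z - zs‖ := by linarith
      have ht : 0 ≤ R / ‖z - zs‖ := by positivity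
      have ht1 : R / ‖z - zs‖ ≤ 1 := (div_le_one hdpos).2 (by linarith)
      refine ⟨zs + (R / ‖z - zs‖) • (z - zs), ?_,
        multSublevel_mono ?_ (combination_mem_multSublevel hzs hz ht ht1)⟩
      · rw [mem_sphere_iff_norm, add_sub_cancel_left, norm_smul, Real.norm_of_nonneg ht,
          div_mul_cancel₀ _ hdpos.ne']
      · rw [div_mul_eq_mul_div, div_le_div_iff₀ hdpos (by positivity)]
        have h1 : R * c ≤ R * |c| := mul_le_mul_of_nonneg_left (le_abs_self c) hRpos.le
        have h2 : R * c * (k + 1) ≤ R * |c| * (k + 1) :=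
          mul_le_mul_of_nonneg_right h1 (by positivity)
        linarith
    · exact (isCompact_sphere zs R).inter_right (isClosed_multSublevel _)
    · exact fun k => Metric.isClosed_sphere.inter (isClosed_multSublevel _)
  obtain ⟨u, hu⟩ := hK
  rw [Set.mem_iInter] at hu
  have hlim : Filter.Tendsto (fun k : ℕ => 1 / ((k : ℝ) + 1)) Filter.atTop (𝓝 0) :=
    tendsto_one_div_add_atTop_nhds_zero_nat
  have hu0 : u ∈ multSublevel C xbar 0 :=
    ⟨fun y hy => ge_of_tendsto' hlim fun k => (hu k).2.1 y hy,
      ge_of_tendsto' hlim fun k => (hu k).2.2⟩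
  have h1 := hM u hu0
  have h2 : ‖u - zs‖ = R := mem_sphere_iff_norm.1 (hu 0).1
  have h3 := norm_sub_le u zs
  linarith

/-- Optimal multipliers can be completed by edge blocks to a sparse dual variable with primal point
`0`, to which the upper bound in the regularity assumption applies. -/
theorem RegularSets.exists_bound_optimal {G : SimpleGraph V} [Fintype G.edgeSet]
    (hconn : G.Connected) (h0 : ∀ i, (0 : Vec m) ∈ C i) (hreg : RegularSets G C xbar 0) :
    ∃ M, ∀ z ∈ multSublevel C xbar 0, ‖z‖ ≤ M := by
  classical
  obtain ⟨U, hU, Mmax, Mmin, κ, hMmax, -, -, hall⟩ := hreg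
  have h0U : (0 : Vec m) ∈ U := mem_of_mem_nhds hU
  refine ⟨Mmax, fun z hz => ?_⟩
  rw [mem_multSublevel_zero_iff h0] at hz
  obtain ⟨y, hy, hysum⟩ := exists_sum_edgeSparse (m := m) hconn
    (WithLp.toLp 2 fun i => xbar - z i) (by
      simp [Finset.sum_sub_distrib, hz.2, Nat.cast_smul_eq_nsmul])
  let Z : DualVar G m := Sum.elim (fun i => PiLp.single 2 i (z i)) y
  have hZ : ∀ i, Z (Sum.inl i) i = z i := fun i => by simp [Z]
  have hsp : IsSparse G Z := ⟨fun i j hj => by simp [Z, hj], hy⟩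
  have hprimal : ∀ j, primalPoint G xbar Z j = 0 := fun j => by
    have h1 : ∑ i, Z (Sum.inl i) j = z j := by
      rw [Fintype.sum_eq_single j fun i hi => hsp.1 i j hi.symm, hZ]
    have h2 : ∑ e : G.edgeSet, y e j = xbar - z j := by
      have := congrArg (fun w : ProdVec V m => w j) hysum
      simpa using this
    have h3 : primalPoint G xbar Z j =
        xbar - (∑ i, Z (Sum.inl i) j + ∑ e : G.edgeSet, Z (Sum.inr e) j) := by
      simp [primalPoint, diagVec, Fintype.sum_sum_type]
    rw [h3, h1]
    change xbar - (z j + ∑ e : G.edgeSet, y e j) = 0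
    rw [h2]
    abel
  have hb := hall Z 0 hsp (fun _ => h0U) (fun i => by rw [hZ]; exact hz.1 i)
    (fun j => by rw [hprimal]; exact h0U)
  refine (pi_norm_le_iff_of_nonneg (by linarith)).2 fun i => ?_
  rw [← hZ]
  exact (hb.1 i).2

end Coercivity

/-! ### Distance to the optimal multipliers near the solution -/

section Multipliers

variable {V : Type*} [Fintype V] {m : ℕ} {C : V → Set (Vec m)} {xbar : Vec m}

theorem isClosed_normalCone {X : Type*} [NormedAddCommGroup X] [InnerProductSpace ℝ X]
    (D : Set X) (x : X) : IsClosed (normalCone D x) := by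
  unfold normalCone
  simp only [Set.ofPred_and, Set.ofPred_forall]
  exact isClosed_const.inter (isClosed_iInter fun y => isClosed_iInter fun _ =>
    isClosed_le (by fun_prop) continuous_const)

theorem isClosed_multM1_inter_multM2 (x : Vec m) :
    IsClosed (multM1 C x ∩ multM2 V xbar) := by
  refine IsClosed.inter ?_ (isClosed_eq (by fun_prop) continuous_const)
  unfold multM1
  simp only [Set.ofPred_forall]
  exact isClosed_iInter fun i => (isClosed_normalCone (C i) x).preimage
    (by fun_prop : Continuous fun z : ProdVec V m => z i)

/-- Adding the whole defect to one component reaches `M₂`. -/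
theorem infDist_multM2_le [Nonempty V] (z : ProdVec V m) :
    Metric.infDist z (multM2 V xbar) ≤ ‖(Fintype.card V : ℝ) • xbar - ∑ i, z i‖ := by
  classical
  obtain ⟨i⟩ := ‹Nonempty V›
  set w := (Fintype.card V : ℝ) • xbar - ∑ i, z i with hw
  have hmem : z + (PiLp.single 2 i w : ProdVec V m) ∈ multM2 V xbar := by
    change ∑ j, (z + (PiLp.single 2 i w : ProdVec V m)) j = _
    have : ∑ j, (PiLp.single 2 i w : ProdVec V m) j = w := by
      rw [Fintype.sum_eq_single i fun j hj => by simp [hj]]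
      simp
    simp only [PiLp.add_apply, Finset.sum_add_distrib, this]
    rw [hw]
    abel
  refine (Metric.infDist_le_dist_of_mem hmem).trans (le_of_eq ?_)
  rw [dist_eq_norm, sub_add_cancel_left, norm_neg, PiLp.norm_single]

/-- The first order property compares directions only; since the normal cone is a cone, `zr` may be
rescaled to the length of `z`. -/
theorem exists_normal_near {Ci : Set (Vec m)} {z a : Vec m} {κ B e : ℝ} (h0 : 0 ∈ Ci)
    (hκ : 0 < κ) (hzB : ‖z‖ ≤ B) (ha : ‖a‖ ≤ e)
    (h : z ≠ 0 → ∃ zr ∈ normalCone Ci 0, zr ≠ 0 ∧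
      ‖(‖z‖⁻¹ • z) - (‖zr‖⁻¹ • zr)‖ ≤ κ * ‖a‖) :
    ∃ zr ∈ normalCone Ci 0, ‖z - zr‖ ≤ B * (κ * e) := by
  by_cases hz : z = 0
  · refine ⟨0, zero_mem_normalCone h0, ?_⟩
    have h1 := (norm_nonneg z).trans hzB
    have h2 := (norm_nonneg a).trans ha
    rw [hz, sub_zero, norm_zero]
    positivity
  · obtain ⟨zr, hzr, -, hle⟩ := h hz
    refine ⟨(‖z‖ * ‖zr‖⁻¹) • zr, smul_mem_normalCone hzr (by positivity), ?_⟩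
    have h1 : z - (‖z‖ * ‖zr‖⁻¹) • zr = ‖z‖ • ((‖z‖⁻¹ • z) - (‖zr‖⁻¹ • zr)) := by
      rw [smul_sub, smul_smul, smul_smul, mul_inv_cancel₀ (norm_ne_zero_iff.2 hz), one_smul]
    rw [h1, norm_smul, norm_norm]
    exact mul_le_mul hzB (hle.trans (mul_le_mul_of_nonneg_left ha hκ.le)) (norm_nonneg _)
      ((norm_nonneg z).trans hzB)

/-- Near the solution, bounded multipliers have distance `O(e)` to the optimal multipliers,
where `e` is the distance of the corresponding primal points to the solution. -/
theorem exists_optimal_multipliers_near [Nonempty V] (h0 : ∀ i, (0 : Vec m) ∈ C i)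
    (hdual : DualMinimizerExists C xbar 0) (hnormals : FirstOrderNormals C 0)
    (hmult : RegularMultipliers C xbar 0) {B : ℝ} (hB : 0 ≤ B) :
    ∃ δ L : ℝ, 0 < δ ∧ 0 ≤ L ∧ ∀ (z a x : V → Vec m) (e : ℝ),
      (∀ i, z i ∈ normalCone (C i) (a i)) → (∀ i, ‖z i‖ ≤ B) → (∀ i, ‖a i‖ ≤ e) →
      (∀ i, ‖x i‖ ≤ e) → e < δ → ∑ i, x i = (Fintype.card V : ℝ) • xbar - ∑ i, z i →
      ∃ zo : V → Vec m, (∀ i, zo i ∈ normalCone (C i) 0) ∧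
        ∑ i, zo i = (Fintype.card V : ℝ) • xbar ∧ ∀ i, ‖z i - zo i‖ ≤ L * e := by
  obtain ⟨U, hU, κ₃, hκ₃, hn⟩ := hnormals
  obtain ⟨κ₄, hκ₄, hm⟩ := hmult
  obtain ⟨δ, hδ, hball⟩ := Metric.mem_nhds_iff.1 hU
  obtain ⟨zs, hzs, hzssum⟩ := hdual
  have hne : (multM1 C 0 ∩ multM2 V xbar).Nonempty := ⟨WithLp.toLp 2 zs, hzs, hzssum⟩
  -- The first summand is the cost of moving `z` into `M₁`. The second is `κ₄` times the resulting
  -- defect in the sum constraint, by linear regularity.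
  refine ⟨δ, B * κ₃ + κ₄ * (Fintype.card V * (1 + B * κ₃)), hδ, by positivity, ?_⟩
  intro z a x e hz hzB ha hx he hsum
  have hzr : ∀ i, ∃ zr ∈ normalCone (C i) 0, ‖z i - zr‖ ≤ B * (κ₃ * e) := fun i => by
    refine exists_normal_near (h0 i) hκ₃ (hzB i) (ha i) fun hzi => ?_
    have haU : a i ∈ U := hball (by rw [mem_ball_zero_iff]; exact (ha i).trans_lt he)
    simpa using hn i (a i) ⟨haU, (hz i).1⟩ (z i) (hz i) hzi
  choose zr hzrN hzr using hzr
  obtain ⟨zo, hzo, hdist⟩ := (isClosed_multM1_inter_multM2 (C := C) (xbar := xbar)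
    0).exists_infDist_eq_dist hne (WithLp.toLp 2 zr)
  refine ⟨zo, hzo.1, hzo.2, fun i => ?_⟩
  have h1 := hm (WithLp.toLp 2 zr) hzrN
  have h2 := infDist_multM2_le (xbar := xbar) (WithLp.toLp 2 zr : ProdVec V m)
  have h3 : ‖(Fintype.card V : ℝ) • xbar - ∑ i, zr i‖ ≤
      Fintype.card V * (e + B * (κ₃ * e)) := by
    have h4 : (Fintype.card V : ℝ) • xbar - ∑ i, zr i = ∑ i, (x i + (z i - zr i)) := by
      rw [Finset.sum_add_distrib, hsum, Finset.sum_sub_distrib]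
      abel
    rw [h4]
    refine (norm_sum_le_of_le _ fun i _ =>
      (norm_add_le _ _).trans (add_le_add (hx i) (hzr i))).trans ?_
    simp [mul_add]
  have h5 : ‖zr i - zo i‖ ≤ Metric.infDist (WithLp.toLp 2 zr) (multM1 C 0 ∩ multM2 V xbar) := by
    rw [hdist, dist_eq_norm]
    exact PiLp.norm_apply_le ((WithLp.toLp 2 zr : ProdVec V m) - zo) i
  have h6 := norm_sub_le_norm_sub_add_norm_sub (z i) (zr i) (zo i)
  have h7 := mul_le_mul_of_nonneg_left (h2.trans h3) hκ₄.le
  have h8 := hzr i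
  linarith

end Multipliers

/-! ### One outer iteration -/

section Run

theorem norm_sub_le_sum_range {E : Type*} [NormedAddCommGroup E] {x : ℕ → E}
    {w k : ℕ} (hw : w ≤ k) :
    ‖x w - x k‖ ≤ ∑ v ∈ Finset.range k, ‖x (v + 1) - x v‖ := by
  rw [← dist_eq_norm]
  refine (dist_le_Ico_sum_dist x hw).trans ?_
  simp_rw [dist_comm (x _) (x (_ + 1)), dist_eq_norm]
  refine Finset.sum_le_sum_of_subset_of_nonneg (fun v hv => ?_) fun _ _ _ => norm_nonneg _
  exact Finset.mem_range.2 (Finset.mem_Ico.1 hv).2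

variable {V : Type*} [Fintype V] {m : ℕ} {G : SimpleGraph V} [Fintype G.edgeSet]
  {C : V → Set (Vec m)} {xbar : Vec m} {wbar : ℕ} {S : ℕ → ℕ → Finset (Block G)}
  {z : ℕ → ℕ → DualVar G m}

theorem IsDykstraRun.isSparse (h0 : ∀ i, (0 : Vec m) ∈ C i)
    (hclosed : ∀ i, IsClosed (C i)) (hconvex : ∀ i, Convex ℝ (C i))
    (h : IsDykstraRun G C xbar wbar S z) {n : ℕ} (hn : 1 ≤ n) {w : ℕ} (hw : w ≤ wbar) :
    IsSparse G (z n w) := by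
  have hinner : ∀ n, 1 ≤ n → IsSparse G (z n 0) → ∀ w, w ≤ wbar → IsSparse G (z n w) := by
    intro n hn hz w
    induction w with
    | zero => exact fun _ => hz
    | succ w ih => exact fun hw =>
        (h.step n hn w hw).isSparse h0 hclosed hconvex (ih (Nat.le_of_succ_le hw))
  refine hinner n hn ?_ w hw
  induction n, hn using Nat.le_induction with
  | base => exact h.init
  | succ n hn ih =>
    rw [h.next n hn]
    exact hinner n hn ih wbar le_rfl

/-- A block is frozen after its last update, so the normality gained there survives to the end of
the iteration. -/
theorem IsDykstraRun.exists_last_update (h : IsDykstraRun G C xbar wbar S z) {n : ℕ}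
    (hn : 1 ≤ n) (α : Block G) (hα : ∃ w, 1 ≤ w ∧ w ≤ wbar ∧ α ∈ S n w) :
    ∃ w, w < wbar ∧ α ∈ S n (w + 1) ∧ z n wbar α = z n (w + 1) α := by
  have hind : ∀ k, k ≤ wbar → (∃ w, 1 ≤ w ∧ w ≤ k ∧ α ∈ S n w) →
      ∃ w, w < k ∧ α ∈ S n (w + 1) ∧ z n k α = z n (w + 1) α := by
    intro k
    induction k with
    | zero =>
      rintro - ⟨w, h1, h2, -⟩
      omega
    | succ k ih =>
      rintro hk ⟨w, hw1, hwk, hw⟩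
      by_cases hS : α ∈ S n (k + 1)
      · exact ⟨k, Nat.lt_succ_self k, hS, rfl⟩
      · have hwk' : w ≤ k := by
          rcases Nat.lt_or_ge k w with h1 | h1
          · obtain rfl : w = k + 1 := by omega
            exact absurd hw hS
          · exact h1
        obtain ⟨v, hv, hvS, heq⟩ := ih (Nat.le_of_succ_le hk) ⟨w, hw1, hwk', hw⟩
        exact ⟨v, by omega, hvS, ((h.step n hn k hk).1 α hS).trans heq⟩
  exact hind wbar le_rfl hα

theorem IsDykstraRun.blockF_add_sum_le (h0 : ∀ i, (0 : Vec m) ∈ C i)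
    (hclosed : ∀ i, IsClosed (C i)) (hconvex : ∀ i, Convex ℝ (C i))
    (h : IsDykstraRun G C xbar wbar S z) {n : ℕ} (hn : 1 ≤ n) {k : ℕ} (hk : k ≤ wbar) :
    blockF G C xbar (z n k) + ((1 / 2 * ∑ w ∈ Finset.range k,
      ‖primalPoint G xbar (z n (w + 1)) - primalPoint G xbar (z n w)‖ ^ 2 : ℝ) : EReal) ≤
      blockF G C xbar (z n 0) := by
  induction k with
  | zero => simp
  | succ k ih =>
    refine le_trans ?_ (ih (Nat.le_of_succ_le hk))
    have h1 := (h.step n hn k hk).blockF_add_le h0 hclosed hconvex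
    rw [Finset.sum_range_succ, mul_add, add_comm (1 / 2 * _ : ℝ), EReal.coe_add, ← add_assoc]
    exact add_le_add_left h1 _

/-- The constant in the sufficient decrease of the dual value. -/
noncomputable def decreaseConst (V : Type*) [Fintype V] (wbar : ℕ) : ℝ :=
  (2 * ((wbar : ℝ) + 1) * (2 * Fintype.card V + 1) ^ 2)⁻¹

theorem decreaseConst_pos : 0 < decreaseConst V wbar := by
  unfold decreaseConst
  positivity

/-- This is Cauchy–Schwarz over the inner steps; `wbar + 1` in place of `wbar` keeps the constant
positive for `wbar = 0`. -/
theorem decreaseConst_mul_sq_le (d : ℕ → ℝ) :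
    decreaseConst V wbar * ((2 * Fintype.card V + 1) * ∑ w ∈ Finset.range wbar, d w) ^ 2 ≤
      1 / 2 * ∑ w ∈ Finset.range wbar, d w ^ 2 := by
  have h1 : (∑ w ∈ Finset.range wbar, d w) ^ 2 ≤
      wbar * ∑ w ∈ Finset.range wbar, d w ^ 2 := by
    simpa using sq_sum_le_card_mul_sum_sq (s := Finset.range wbar) (f := d)
  have h2 : 0 ≤ ∑ w ∈ Finset.range wbar, d w ^ 2 := Finset.sum_nonneg fun _ _ => sq_nonneg _
  have hN : (0 : ℝ) < (2 * Fintype.card V + 1) ^ 2 := by positivity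
  have hw : (0 : ℝ) < 2 * ((wbar : ℝ) + 1) := by positivity
  unfold decreaseConst
  rw [inv_mul_le_iff₀ (by positivity), mul_pow]
  have h3 : (∑ w ∈ Finset.range wbar, d w) ^ 2 ≤
      ((wbar : ℝ) + 1) * ∑ w ∈ Finset.range wbar, d w ^ 2 := by linarith
  have h4 := mul_le_mul_of_nonneg_left h3 hN.le
  linarith

/-- The state of the algorithm after an outer iteration: the vertex multipliers are normal
vectors at points `a i` that are `ε`-close to all components of the primal point, and the dual
value has decreased by at least a multiple of `ε²`. -/
theorem IsDykstraRun.exists_normal_points (hconn : G.Connected) (h0 : ∀ i, (0 : Vec m) ∈ C i)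
    (hclosed : ∀ i, IsClosed (C i)) (hconvex : ∀ i, Convex ℝ (C i))
    (h : IsDykstraRun G C xbar wbar S z) (hall : UpdatesAllBlocks G wbar S) (i₀ : V) {n : ℕ}
    (hn : 1 ≤ n) :
    ∃ (a : V → Vec m) (ε : ℝ), 0 ≤ ε ∧
      (∀ i, z (n + 1) 0 (Sum.inl i) i ∈ normalCone (C i) (a i)) ∧
      (∀ i, ‖primalPoint G xbar (z (n + 1) 0) i - primalPoint G xbar (z (n + 1) 0) i₀‖ ≤ ε) ∧
      (∀ i, ‖a i - primalPoint G xbar (z (n + 1) 0) i₀‖ ≤ ε) ∧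
      dualF G C xbar (z (n + 1) 0) =
        ((∑ i, inner ℝ (z (n + 1) 0 (Sum.inl i) i) (a i) +
          1 / 2 * ∑ i, ‖primalPoint G xbar (z (n + 1) 0) i‖ ^ 2 : ℝ) : EReal) ∧
      dualF G C xbar (z (n + 1) 0) + ((decreaseConst V wbar * ε ^ 2 : ℝ) : EReal) ≤
        dualF G C xbar (z n 0) := by
  have hlast := fun α => h.exists_last_update hn α (hall n hn α)
  choose w hw hwS hwz using hlast
  let x : ℕ → ProdVec V m := fun k => primalPoint G xbar (z n k)
  have hN : ∀ α, z n wbar α ∈ normalCone (blockSet G C α) (x (w α + 1)) := fun α => by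
    rw [hwz]
    exact (h.step n hn (w α) (hw α)).mem_normalCone h0 hclosed hconvex (hwS α)
  have hx : primalPoint G xbar (z (n + 1) 0) = x wbar := by rw [h.next n hn]
  have hsp := h.isSparse h0 hclosed hconvex hn le_rfl
  rw [hx, h.next n hn, hsp.dualF_eq,
    (h.isSparse h0 hclosed hconvex hn (Nat.zero_le _)).dualF_eq]
  obtain ⟨s, hs⟩ : ∃ s, s = ∑ v ∈ Finset.range wbar, ‖x (v + 1) - x v‖ := ⟨_, rfl⟩
  have hs0 : 0 ≤ s := hs ▸ Finset.sum_nonneg fun _ _ => norm_nonneg _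
  have hclose : ∀ k, k ≤ wbar → ∀ i, ‖x k i - x wbar i‖ ≤ s := fun k hk i =>
    (PiLp.norm_apply_le (x k - x wbar) i).trans (hs ▸ norm_sub_le_sum_range hk)
  have hadj : ∀ i j, G.Adj i j → ‖x wbar i - x wbar j‖ ≤ 2 * s := by
    intro i j hij
    let α : Block G := Sum.inr ⟨s(i, j), hij⟩
    have h1 : x (w α + 1) i = x (w α + 1) j := (hN α).1 i (by simp) j (by simp)
    have h2 := hclose (w α + 1) (hw α) i
    have h3 := hclose (w α + 1) (hw α) j
    have h4 : x wbar i - x wbar j =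
        (x (w α + 1) j - x wbar j) - (x (w α + 1) i - x wbar i) := by
      rw [h1]
      abel
    rw [h4]
    exact (norm_sub_le _ _).trans (by linarith)
  have hdev := norm_sub_le_of_connected hconn hadj (by positivity)
  -- In `ε`, `2|V|s` comes from walking along edges and one more `s` from the movement after the
  -- last update of vertex `i`.
  refine ⟨fun i => x (w (Sum.inl i) + 1) i, (2 * Fintype.card V + 1) * s, by positivity,
    fun i => (vertexSparse_of_mem_normalCone (hN (Sum.inl i))).2, fun i => ?_, fun i => ?_,
    ?_, ?_⟩
  · have := hdev i i₀
    linarith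
  · have h1 := hdev i i₀
    have h2 := hclose (w (Sum.inl i) + 1) (hw _) i
    have h3 := norm_sub_le_norm_sub_add_norm_sub (x (w (Sum.inl i) + 1) i) (x wbar i)
      (x wbar i₀)
    linarith
  · rw [← hsp.dualF_eq]
    unfold dualF
    have h1 : ∑ e : G.edgeSet, supportFn (edgeSubspace m (e : Sym2 V)) (z n wbar (Sum.inr e)) =
        0 := by
      refine Finset.sum_eq_zero fun e _ => ?_
      have hNe : z n wbar (Sum.inr e) ∈ normalCone (edgeSubspace m (e : Sym2 V)) _ :=
        hN (Sum.inr e)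
      rw [supportFn_eq_of_mem_normalCone hNe,
        (hsp.edgeSparse e).sum_inner (not_isDiag_of_edge e) hNe.1, EReal.coe_zero]
    have h2 : ∀ i, supportFn (C i) (z n wbar (Sum.inl i) i) =
        ((inner ℝ (z n wbar (Sum.inl i) i) (x (w (Sum.inl i) + 1) i) : ℝ) : EReal) := fun i =>
      supportFn_eq_of_mem_normalCone (vertexSparse_of_mem_normalCone (hN (Sum.inl i))).2
    rw [h1, add_zero, Finset.sum_congr rfl fun i _ => h2 i, ← ereal_coe_sum, ← EReal.coe_add,
      PiLp.norm_sq_eq_of_L2]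
  · refine le_trans ?_ (h.blockF_add_sum_le h0 hclosed hconvex hn le_rfl)
    refine add_le_add_right (EReal.coe_le_coe_iff.2 ?_) _
    rw [hs]
    exact decreaseConst_mul_sq_le fun v => ‖x (v + 1) - x v‖

end Run

/-! ### Real sequences: contraction and geometric bounds -/

section Sequences

theorem tendsto_zero_of_sufficient_decrease {f e : ℕ → ℝ} {γ : ℝ} (hγ : 0 < γ)
    (hf : ∀ k, 0 ≤ f k) (he : ∀ k, 0 ≤ e k)
    (hdec : ∀ k, f (k + 1) + γ * e (k + 1) ^ 2 ≤ f k) :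
    Filter.Tendsto e Filter.atTop (𝓝 0) := by
  have hanti : Antitone f := antitone_nat_of_succ_le fun k => by
    have h1 := hdec k
    have h2 : 0 ≤ γ * e (k + 1) ^ 2 := by positivity
    linarith
  have hlim := tendsto_atTop_ciInf hanti ⟨0, by rintro _ ⟨k, rfl⟩; exact hf k⟩
  have hdiff := ((hlim.sub (hlim.comp (Filter.tendsto_add_atTop_nat 1))).div_const γ).sqrt
  rw [sub_self, zero_div, Real.sqrt_zero] at hdiff
  rw [← Filter.tendsto_add_atTop_iff_nat 1]
  refine squeeze_zero (fun k => he _) (fun k => ?_) hdiff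
  refine Real.le_sqrt_of_sq_le ?_
  rw [le_div_iff₀ hγ]
  have := hdec k
  simp only [Function.comp_apply]
  linarith

/-- The coarse bound serves only to force `f → 0`, after which the fine bound applies; eliminating
`e (k + 1) ^ 2` between it and the decrease gives the ratio. -/
theorem eventually_contraction {f e : ℕ → ℝ} {γ δ A N K : ℝ} (hγ : 0 < γ) (hδ : 0 < δ)
    (hK : 0 < K) (hf : ∀ k, 0 ≤ f k) (he : ∀ k, 0 ≤ e k)
    (hdec : ∀ k, f (k + 1) + γ * e (k + 1) ^ 2 ≤ f k)
    (hcoarse : ∀ k, f k ≤ N * (A * e k + e k ^ 2))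
    (hfine : ∀ k, f k ≤ 1 → √(2 * f k) + e k < δ → f k ≤ K * e k ^ 2) :
    ∃ k₀, ∀ k, k₀ ≤ k → f (k + 1) ≤ K / (γ + K) * f k := by
  have he0 := tendsto_zero_of_sufficient_decrease hγ hf he hdec
  have hf0 : Filter.Tendsto f Filter.atTop (𝓝 0) := by
    have h1 := ((he0.const_mul A).add (he0.pow 2)).const_mul N
    simp only [mul_zero, ne_eq, OfNat.ofNat_ne_zero, not_false_eq_true, zero_pow, add_zero] at h1
    exact squeeze_zero hf hcoarse h1
  have hs0 := (hf0.const_mul 2).sqrt.add he0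
  rw [mul_zero, Real.sqrt_zero, add_zero] at hs0
  obtain ⟨k₀, hk₀⟩ := Filter.eventually_atTop.1
    ((hf0.eventually_le_const one_pos).and (hs0.eventually_lt_const hδ))
  refine ⟨k₀, fun k hk => ?_⟩
  obtain ⟨h1, h2⟩ := hk₀ (k + 1) (by omega)
  have h3 := hfine (k + 1) h1 h2
  have h4 := mul_le_mul_of_nonneg_left (hdec k) hK.le
  have h5 := mul_le_mul_of_nonneg_left h3 hγ.le
  rw [div_mul_eq_mul_div, le_div_iff₀ (by positivity)]
  linarith

/-- Only finitely many steps precede `k₀`, and each of them has some ratio below one. -/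
theorem exists_uniform_contraction {f : ℕ → ℝ} {r : ℝ} {k₀ : ℕ} (hr1 : r < 1)
    (hf : ∀ k, 0 ≤ f k) (hk₀ : ∀ k, k₀ ≤ k → f (k + 1) ≤ r * f k)
    (hstrict : ∀ k, f (k + 1) < f k ∨ f (k + 1) ≤ 0) :
    ∃ r₀, 0 < r₀ ∧ r₀ < 1 ∧ ∀ k, f (k + 1) ≤ r₀ * f k := by
  have hfin : ∀ K : ℕ, ∃ s, 0 < s ∧ s < 1 ∧ ∀ k, k < K → f (k + 1) ≤ s * f k := by
    intro K
    induction K with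
    | zero => exact ⟨1 / 2, by norm_num, by norm_num, fun k hk => absurd hk (Nat.not_lt_zero k)⟩
    | succ K ih =>
      obtain ⟨s, hs, hs1, hsK⟩ := ih
      obtain ⟨t, ht1, htK⟩ : ∃ t, t < 1 ∧ f (K + 1) ≤ t * f K := by
        rcases hstrict K with h | h
        · have hpos : 0 < f K := (hf (K + 1)).trans_lt h
          exact ⟨f (K + 1) / f K, (div_lt_one hpos).2 h, (div_mul_cancel₀ _ hpos.ne').ge⟩
        · exact ⟨0, one_pos, by simpa using h⟩
      refine ⟨max s t, lt_max_of_lt_left hs, max_lt hs1 ht1, fun k hk => ?_⟩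
      rcases Nat.lt_succ_iff_lt_or_eq.1 hk with h | rfl
      · exact (hsK k h).trans (mul_le_mul_of_nonneg_right (le_max_left _ _) (hf k))
      · exact htK.trans (mul_le_mul_of_nonneg_right (le_max_right _ _) (hf k))
  obtain ⟨s, hs, hs1, hsK⟩ := hfin k₀
  refine ⟨max s r, lt_max_of_lt_left hs, max_lt hs1 hr1, fun k => ?_⟩
  rcases Nat.lt_or_ge k k₀ with h | h
  · exact (hsK k h).trans (mul_le_mul_of_nonneg_right (le_max_left _ _) (hf k))
  · exact (hk₀ k h).trans (mul_le_mul_of_nonneg_right (le_max_right _ _) (hf k))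

theorem exists_geometric_bound {b : ℕ → ℝ} {ρ A : ℝ} {N : ℕ} (hρ : 0 < ρ) (hb : ∀ n, 0 ≤ b n)
    (h : ∀ j, b (N + j) ≤ A * ρ ^ j) : ∃ K, 0 ≤ K ∧ ∀ n, b n ≤ K * ρ ^ n := by
  have hA : 0 ≤ A := by simpa using (hb _).trans (h 0)
  have hsum : 0 ≤ ∑ n ∈ Finset.range N, b n / ρ ^ n :=
    Finset.sum_nonneg fun n _ => div_nonneg (hb n) (by positivity)
  refine ⟨A / ρ ^ N + ∑ n ∈ Finset.range N, b n / ρ ^ n, by positivity, fun n => ?_⟩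
  rw [← div_le_iff₀ (by positivity)]
  rcases Nat.lt_or_ge n N with hn | hn
  · have h1 := Finset.single_le_sum (f := fun n => b n / ρ ^ n)
      (fun n _ => div_nonneg (hb n) (by positivity)) (Finset.mem_range.2 hn)
    have h2 : 0 ≤ A / ρ ^ N := by positivity
    linarith
  · obtain ⟨j, rfl⟩ := Nat.exists_eq_add_of_le hn
    have h1 : b (N + j) / ρ ^ (N + j) ≤ A / ρ ^ N := by
      rw [div_le_div_iff₀ (by positivity) (by positivity), pow_add]
      have := mul_le_mul_of_nonneg_right (h j) (by positivity : 0 ≤ ρ ^ N)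
      linarith
    linarith

/-- Young's inequality bounds `N * L * √(2 * f) * e` by `f / 2 + (N * L * e) ^ 2`, and the half is
absorbed on the left. -/
theorem le_mul_sq_of_le_sqrt {f N L e : ℝ} (hf : 0 ≤ f)
    (h : f ≤ N * (L * (√(2 * f) + e) * e + e ^ 2)) :
    f ≤ 2 * ((N * L) ^ 2 + N * L + N) * e ^ 2 := by
  have h1 := Real.sq_sqrt (by positivity : 0 ≤ 2 * f)
  have h2 := sq_nonneg (√(2 * f) - 2 * (N * L * e))
  nlinarith

end Sequences

/-! ### Error bounds for the dual value -/

section Rate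

variable {V : Type*} [Fintype V] {m : ℕ} {C : V → Set (Vec m)} {xbar : Vec m}

theorem mem_multSublevel_of_normal {z a x : V → Vec m} {f : ℝ}
    (hz : ∀ i, z i ∈ normalCone (C i) (a i))
    (hsum : ∑ i, x i = (Fintype.card V : ℝ) • xbar - ∑ i, z i)
    (hf : ∑ i, (inner ℝ (z i) (a i) : ℝ) + 1 / 2 * ∑ i, ‖x i‖ ^ 2 ≤ f) (hf0 : 0 ≤ f)
    [Nonempty V] (hx : ∀ i, ‖x i‖ ≤ √(2 * f)) :
    z ∈ multSublevel C xbar (Fintype.card V * (f + 1)) := by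
  have hN : (1 : ℝ) ≤ Fintype.card V := by exact_mod_cast Fintype.card_pos (α := V)
  refine ⟨fun y hy => ?_, ?_⟩
  · have h1 : ∑ i, (inner ℝ (z i) (y i) : ℝ) ≤ ∑ i, inner ℝ (z i) (a i) :=
      Finset.sum_le_sum fun i _ => inner_le_of_mem_normalCone (hz i) (hy i)
    have h2 : 0 ≤ ∑ i, ‖x i‖ ^ 2 := Finset.sum_nonneg fun _ _ => sq_nonneg _
    nlinarith
  · rw [norm_sub_rev, ← hsum]
    have h1 : √(2 * f) ≤ f + 1 := Real.sqrt_le_iff.2 ⟨by linarith, by nlinarith⟩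
    refine (norm_sum_le_of_le _ fun i _ => (hx i).trans h1).trans ?_
    simp [mul_add]

/-- Error bounds for the dual value in terms of the deviation `ε`: a bound linear in `ε` on
each sublevel set, and a uniform quadratic bound near the solution. -/
theorem exists_error_bounds {G : SimpleGraph V} [Fintype G.edgeSet] (hconn : G.Connected)
    (h0 : ∀ i, (0 : Vec m) ∈ C i) (hdual : DualMinimizerExists C xbar 0)
    (hreg : RegularSets G C xbar 0) (hnormals : FirstOrderNormals C 0)
    (hmult : RegularMultipliers C xbar 0) (i₀ : V) :
    ∃ δ K : ℝ, 0 < δ ∧ 0 < K ∧ ∀ c : ℝ, ∃ A : ℝ, ∀ (z a x : V → Vec m) (f ε : ℝ),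
      0 ≤ ε → (∀ i, z i ∈ normalCone (C i) (a i)) →
      (∀ i, ‖x i - x i₀‖ ≤ ε) → (∀ i, ‖a i - x i₀‖ ≤ ε) →
      ∑ i, x i = (Fintype.card V : ℝ) • xbar - ∑ i, z i →
      f = ∑ i, (inner ℝ (z i) (a i) : ℝ) + 1 / 2 * ∑ i, ‖x i‖ ^ 2 →
      (f ≤ c → f ≤ Fintype.card V * (A * ε + ε ^ 2)) ∧
      (f ≤ 1 → √(2 * f) + ε < δ → f ≤ K * ε ^ 2) := by
  have : Nonempty V := ⟨i₀⟩
  have hN : (1 : ℝ) ≤ Fintype.card V := by exact_mod_cast Fintype.card_pos (α := V)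
  obtain ⟨zs, hzs⟩ := id hdual
  have hzs0 := (mem_multSublevel_zero_iff h0).2 hzs
  obtain ⟨M, hM⟩ := hreg.exists_bound_optimal hconn h0
  -- This is the level belonging to `f ≤ 1`. It does not involve `c`, so `δ` and `K` are the same
  -- for all runs; only `A` depends on `c`.
  obtain ⟨B, hB⟩ := exists_bound_multSublevel hzs0 hM (Fintype.card V * (1 + 1))
  have hB0 : 0 ≤ B := (norm_nonneg zs).trans (hB zs (multSublevel_mono (by positivity) hzs0))
  obtain ⟨δ, L, hδ, hL, hnear⟩ :=
    exists_optimal_multipliers_near h0 hdual hnormals hmult hB0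
  refine ⟨δ, 2 * ((Fintype.card V * L) ^ 2 + Fintype.card V * L + Fintype.card V), hδ,
    by positivity, fun c => ?_⟩
  obtain ⟨Bc, hBc⟩ := exists_bound_multSublevel hzs0 hM (Fintype.card V * (c + 1))
  refine ⟨Bc + ‖zs‖, fun z a x f ε hε hz hx ha hsum hf => ?_⟩
  have hin : 0 ≤ ∑ i, (inner ℝ (z i) (a i) : ℝ) :=
    Finset.sum_nonneg fun i _ => inner_nonneg_of_mem_normalCone (h0 i) (hz i)
  have hxsum : 0 ≤ ∑ i, ‖x i‖ ^ 2 := Finset.sum_nonneg fun _ _ => sq_nonneg _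
  have hf0 : 0 ≤ f := by rw [hf]; positivity
  have hxf : ∀ i, ‖x i‖ ≤ √(2 * f) := fun i => by
    refine Real.le_sqrt_of_sq_le ?_
    have := Finset.single_le_sum (f := fun i => ‖x i‖ ^ 2) (fun _ _ => sq_nonneg _)
      (Finset.mem_univ i)
    linarith
  have hmem := mem_multSublevel_of_normal hz hsum hf.ge hf0 hxf
  have hgap : ∀ (zo : V → Vec m) (D : ℝ), (∀ i, zo i ∈ normalCone (C i) 0) →
      ∑ i, zo i = (Fintype.card V : ℝ) • xbar → (∀ i, ‖z i - zo i‖ ≤ D) →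
      f ≤ Fintype.card V * (D * ε + ε ^ 2) := fun zo D hzo hzosum hD => by
    rw [hf]
    refine gap_le_of_optimal_multipliers hx ha hD (fun i => ?_) ?_
    · simpa using inner_le_of_mem_normalCone (hzo i) (hz i).1
    · rw [Finset.sum_sub_distrib, hzosum, hsum]
  refine ⟨fun hfc => hgap zs _ hzs.1 hzs.2 fun i => ?_, fun hf1 hfδ => ?_⟩
  · have h1 := hBc z (multSublevel_mono
      (mul_le_mul_of_nonneg_left (by linarith) (by positivity)) hmem)
    exact (norm_sub_le _ _).trans (add_le_add ((norm_le_pi_norm z i).trans h1)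
      (norm_le_pi_norm zs i))
  · have h1 := hB z (multSublevel_mono
      (mul_le_mul_of_nonneg_left (by linarith) (by positivity)) hmem)
    obtain ⟨zo, hzo, hzosum, hD⟩ := hnear z a x (√(2 * f) + ε) hz
      (fun i => (norm_le_pi_norm z i).trans h1)
      (fun i => by
        have h2 := norm_le_norm_add_norm_sub' (a i) (x i₀)
        linarith [ha i, hxf i₀])
      (fun i => by linarith [hxf i]) hfδ hsum
    exact le_mul_sq_of_le_sqrt hf0 (hgap zo _ hzo hzosum hD)

end Rate

end DistDykstra

/-! ### The main theorem -/

theorem theorem3p1 {V : Type*} [Fintype V] {m : ℕ} (G : SimpleGraph V) [Fintype G.edgeSet]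
    (C : V → Set (DistDykstra.Vec m)) (xbar xstar : DistDykstra.Vec m) (wbar : ℕ)
    (hclosed : ∀ i, IsClosed (C i)) (hconvex : ∀ i, Convex ℝ (C i))
    (hproj : DistDykstra.IsProjection C xbar xstar) (hzero : xstar = 0)
    (hdual : DistDykstra.DualMinimizerExists C xbar xstar)
    (hreg : DistDykstra.RegularSets G C xbar xstar)
    (hconn : G.Connected)
    (hsemi : DistDykstra.Semismooth C xstar)
    (hnormals : DistDykstra.FirstOrderNormals C xstar)
    (hmult : DistDykstra.RegularMultipliers C xbar xstar) :
    ∃ r ρ : ℝ, 0 < r ∧ r < 1 ∧ 0 < ρ ∧ ρ < 1 ∧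
      ∀ (S : ℕ → ℕ → Finset (DistDykstra.Block G)) (z : ℕ → ℕ → DistDykstra.DualVar G m),
        DistDykstra.IsDykstraRun G C xbar wbar S z →
        DistDykstra.UpdatesAllBlocks G wbar S →
          -- the dual values are finite after the first outer iteration
          (∀ n, 2 ≤ n → DistDykstra.dualF G C xbar (z n 0) ≠ ⊤) ∧
          -- linear decrease in all outer iterations, with a factor that may depend on the run
          (∃ r₀ : ℝ, 0 < r₀ ∧ r₀ < 1 ∧ ∀ n, 2 ≤ n →
            DistDykstra.dualF G C xbar (z (n + 1) 0) ≤
              (r₀ : EReal) * DistDykstra.dualF G C xbar (z (n - 1) 0)) ∧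
          -- eventually, linear decrease with a factor that is the same for all runs
          (∃ N, 2 ≤ N ∧ ∀ n, N ≤ n →
            DistDykstra.dualF G C xbar (z (n + 1) 0) ≤
              (r : EReal) * DistDykstra.dualF G C xbar (z (n - 1) 0)) ∧
          -- the duality gap bound
          (∀ n, 1 ≤ n →
            ((1 / 2 * ‖DistDykstra.primalPoint G xbar (z n 0) - DistDykstra.diagVec V xstar‖ ^ 2
              : ℝ) : EReal) ≤ DistDykstra.dualF G C xbar (z n 0)) ∧
          -- linear convergence of the primal iterates
          (∃ K : ℝ, 0 ≤ K ∧ ∀ n, 1 ≤ n → ∀ i,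
            ‖DistDykstra.primalPoint G xbar (z n 0) i - xstar‖ ≤ K * ρ ^ n) := by
  open DistDykstra in
  subst hzero
  have h0 : ∀ i, (0 : Vec m) ∈ C i := fun i => Set.mem_iInter.1 hproj.1 i
  obtain ⟨i₀⟩ := hconn.nonempty
  obtain ⟨δ, K, hδ, hK, hbounds⟩ :=
    exists_error_bounds hconn h0 hdual hreg hnormals hmult i₀
  have hγ : 0 < decreaseConst V wbar := decreaseConst_pos
  obtain ⟨r, hrdef⟩ : ∃ r, r = K / (decreaseConst V wbar + K) := ⟨_, rfl⟩
  have hr : 0 < r := by rw [hrdef]; positivity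
  have hr1 : r < 1 := by
    rw [hrdef, div_lt_one (by positivity)]
    linarith
  refine ⟨r, √r, hr, hr1, Real.sqrt_pos.2 hr, by
    rw [← Real.sqrt_one]; exact Real.sqrt_lt_sqrt hr.le hr1, ?_⟩
  intro S z hrun hall
  have hsnap := fun k : ℕ => hrun.exists_normal_points hconn h0 hclosed hconvex hall i₀
    (Nat.le_add_left 1 k)
  choose a e he hz hx ha hF hdecF using hsnap
  -- The shift by two starts at the first iterate that follows a full outer iteration; `dualF` at `z
  -- 1 0` may be infinite.
  let f : ℕ → ℝ := fun k => ∑ i, inner ℝ (z (k + 2) 0 (Sum.inl i) i) (a k i) +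
    1 / 2 * ∑ i, ‖primalPoint G xbar (z (k + 2) 0) i‖ ^ 2
  have hFf : ∀ k, dualF G C xbar (z (k + 2) 0) = (f k : EReal) := hF
  have hsp : ∀ n, 1 ≤ n → IsSparse G (z n 0) := fun n hn =>
    hrun.isSparse h0 hclosed hconvex hn (Nat.zero_le _)
  have hgap : ∀ n, 1 ≤ n →
      ((1 / 2 * ‖primalPoint G xbar (z n 0)‖ ^ 2 : ℝ) : EReal) ≤ dualF G C xbar (z n 0) :=
    fun n hn => by
      rw [(hsp n hn).dualF_eq]
      exact le_add_of_nonneg_left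
        (Finset.sum_nonneg fun α _ => supportFn_nonneg (zero_mem_blockSet h0 α) _)
  have hxf : ∀ k, ‖primalPoint G xbar (z (k + 2) 0)‖ ^ 2 ≤ 2 * f k := fun k => by
    have := hgap (k + 2) (by omega)
    rw [hFf, EReal.coe_le_coe_iff] at this
    linarith
  have hf0 : ∀ k, 0 ≤ f k := fun k => by
    have := (sq_nonneg _).trans (hxf k)
    linarith
  have hdec : ∀ k, f (k + 1) + decreaseConst V wbar * e (k + 1) ^ 2 ≤ f k := fun k => by
    have := hdecF (k + 1)
    rw [hFf (k + 1), hFf k, ← EReal.coe_add, EReal.coe_le_coe_iff] at this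
    exact this
  have hanti : Antitone f := antitone_nat_of_succ_le fun k => by
    have h1 := hdec k
    have h2 : 0 ≤ decreaseConst V wbar * e (k + 1) ^ 2 := by positivity
    linarith
  obtain ⟨A, hA⟩ := hbounds (f 0)
  have hAk := fun k => hA (fun i => z (k + 2) 0 (Sum.inl i) i) (a k)
    (fun i => primalPoint G xbar (z (k + 2) 0) i) (f k) (e k) (he k) (hz k) (hx k) (ha k)
    (hsp (k + 2) (by omega)).sum_primalPoint rfl
  have hcoarse : ∀ k, f k ≤ Fintype.card V * (A * e k + e k ^ 2) := fun k =>
    (hAk k).1 (hanti (Nat.zero_le k))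
  obtain ⟨k₀, hk₀⟩ := eventually_contraction hγ hδ hK hf0 he hdec hcoarse fun k => (hAk k).2
  rw [← hrdef] at hk₀
  -- Without movement (`e (k + 1) = 0`) the coarse bound already gives the value zero; otherwise the
  -- decrease is strict.
  obtain ⟨r₀, hr₀, hr₀1, hr₀f⟩ := exists_uniform_contraction hr1 hf0 hk₀ fun k => by
    rcases (he (k + 1)).eq_or_lt with h | h
    · right
      have := hcoarse (k + 1)
      rw [← h] at this
      simpa using this
    · left
      have h1 := hdec k
      have h2 : 0 < decreaseConst V wbar * e (k + 1) ^ 2 := by positivity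
      linarith
  have hmono : ∀ k, dualF G C xbar (z (k + 2) 0) ≤ dualF G C xbar (z (k + 1) 0) := fun k =>
    (le_add_of_nonneg_right (EReal.coe_nonneg.2 (by positivity))).trans (hdecF k)
  -- The contraction is gained in the second of the two outer iterations; the first contributes only
  -- monotonicity, which holds in `EReal` even from an infinite value.
  have hstep : ∀ (s : ℝ) (k : ℕ), 0 < s → f (k + 1) ≤ s * f k →
      dualF G C xbar (z (k + 3) 0) ≤ (s : EReal) * dualF G C xbar (z (k + 1) 0) := by
    intro s k hs hk
    have h1 : dualF G C xbar (z (k + 3) 0) ≤ (s : EReal) * dualF G C xbar (z (k + 2) 0) := by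
      rw [hFf (k + 1), hFf k, ← EReal.coe_mul]
      exact EReal.coe_le_coe_iff.2 hk
    exact h1.trans (mul_le_mul_of_nonneg_left (hmono k) (EReal.coe_nonneg.2 hs.le))
  refine ⟨fun n hn => ?_, ⟨r₀, hr₀, hr₀1, fun n hn => ?_⟩, ⟨k₀ + 2, by omega, fun n hn => ?_⟩,
    fun n hn => ?_, ?_⟩
  · obtain ⟨k, rfl⟩ := Nat.exists_eq_add_of_le' hn
    rw [hFf]
    exact EReal.coe_ne_top _
  · obtain ⟨k, rfl⟩ := Nat.exists_eq_add_of_le' hn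
    exact hstep r₀ k hr₀ (hr₀f k)
  · obtain ⟨k, rfl⟩ := Nat.exists_eq_add_of_le' ((Nat.le_add_left 2 k₀).trans hn)
    exact hstep r k hr (hk₀ k (by omega))
  · have h1 : diagVec V (0 : Vec m) = 0 := rfl
    rw [h1, sub_zero]
    exact hgap n hn
  · have hpow : ∀ j, f (k₀ + j) ≤ r ^ j * f k₀ := fun j => by
      induction j with
      | zero => simp
      | succ j ih =>
        have h1 := hk₀ (k₀ + j) (by omega)
        have h2 := mul_le_mul_of_nonneg_left ih hr.le
        rw [pow_succ]
        exact (h1.trans h2).trans (by linarith)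
    obtain ⟨K', hK', hK'b⟩ := exists_geometric_bound (N := k₀ + 2) (A := √(2 * f k₀))
      (b := fun n => ‖primalPoint G xbar (z n 0)‖) (Real.sqrt_pos.2 hr)
      (fun n => norm_nonneg _) fun j => by
        have h1 := hxf (k₀ + j)
        have h2 : (√(2 * f k₀) * √r ^ j) ^ 2 = 2 * (r ^ j * f k₀) := by
          rw [mul_pow, ← pow_mul, mul_comm j 2, pow_mul, Real.sq_sqrt hr.le,
            Real.sq_sqrt (by linarith [hf0 k₀])]
          ring
        have h3 : k₀ + 2 + j = k₀ + j + 2 := by omega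
        rw [h3]
        refine le_of_sq_le_sq ?_ (by positivity)
        rw [h2]
        linarith [hpow j]
    refine ⟨K', hK', fun n _ i => ?_⟩
    rw [sub_zero]
    exact (PiLp.norm_apply_le _ i).trans (hK'b n)
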